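/- Let $X=\mathrm{SL}_2(\mathbb{Z})\backslash\mathbb{H}$ be the modular surface, with the measure induced by $\frac{dx\,dy}{y^2}$ (integrals over $X$ are integrals over a fundamental domain). For an even integer $k$ let $S_k$ be the space of holomorphic cusp forms of weight $k$ for $\mathrm{SL}_2(\mathbb{Z})$, with the Petersson inner product $\langle f,g\rangle=\int_X f(z)\overline{g(z)}\,y^k\,\frac{dx\,dy}{y^2}$. For an orthonormal basis $\mathcal{B}_k$ of $S_k$ put $$d\mu^X_k=\frac{1}{|\mathcal{B}_k|}\sum_{f\in\mathcal{B}_k}y^k|f(z)|^2\,\frac{dx\,dy}{y^2}.$$ There is an absolute constant $k_0$ such that for every smooth, compactly supported function $\phi:X\to\mathbb{C}$ (smooth meaning that the pullback of $\phi$ to $\mathbb{H}$ is smooth) there is a constant $C_\phi$, depending only on $\phi$, such that for all even $k\ge k_0$ and every orthonormal basis $\mathcal{B}_k$ of $S_k$, $$\left|\int_X\phi\,d\mu^X_k-\frac{3}{\pi}\int_X\phi\,\frac{dx\,dy}{y^2}\right|\le C_\phi\,k^{-1/2}(\log k)^{1/2}.$$ -/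

import Mathlib

open MeasureTheory UpperHalfPlane
open scoped MatrixGroups Modular Manifold ContDiff

noncomputable section

/-- The modular surface `X = SL(2, ℤ) \ ℍ`, with its quotient topology and measurable structure. -/
abbrev ModularSurface : Type :=
  Quotient (MulAction.orbitRel SL(2, ℤ) ℍ)

/-- The projection `ℍ → SL(2, ℤ) \ ℍ`. -/
def ModularSurface.proj (z : ℍ) : ModularSurface :=
  Quotient.mk (MulAction.orbitRel SL(2, ℤ) ℍ) z

/-- The measure `dx dy / y ^ 2` on `X`. It is computed on the standard fundamental domain `𝒟`,
and the `volume` on `ℍ` is `dx dy / y ^ 2`. -/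
def ModularSurface.hyperbolicMeasure : Measure ModularSurface :=
  ((volume : Measure ℍ).restrict 𝒟).map ModularSurface.proj

/-- The Petersson inner product `∫_X conj (f z) * g z * y ^ k dx dy / y ^ 2` of two cusp forms of
weight `k` for `SL(2, ℤ)`. -/
def peterssonInner {k : ℕ} (f g : CuspForm 𝒮ℒ (k : ℤ)) : ℂ :=
  ∫ z in 𝒟, UpperHalfPlane.petersson (k : ℤ) f g z

/-- The finite set `B` is an orthonormal basis of the space of cusp forms of weight `k` for
`SL(2, ℤ)` with respect to the Petersson inner product. -/
structure IsPeterssonOrthonormalBasis {k : ℕ} (B : Finset (CuspForm 𝒮ℒ (k : ℤ))) : Prop where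
  inner_self : ∀ f ∈ B, peterssonInner f f = 1
  inner_ne : ∀ f ∈ B, ∀ g ∈ B, f ≠ g → peterssonInner f g = 0
  span_eq_top : Submodule.span ℂ (B : Set (CuspForm 𝒮ℒ (k : ℤ))) = ⊤

/-- The averaged mass `|B|⁻¹ ∑_{f ∈ B} y ^ k |f z| ^ 2`, as a function on `ℍ`. -/
def averagedMass {k : ℕ} (B : Finset (CuspForm 𝒮ℒ (k : ℤ))) (z : ℍ) : ℝ :=
  (B.card : ℝ)⁻¹ * ∑ f ∈ B, z.im ^ k * ‖f z‖ ^ 2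

/-- The measure `|B|⁻¹ ∑_{f ∈ B} y ^ k |f z| ^ 2 dx dy / y ^ 2` on `X`. -/
def averagedMassMeasure {k : ℕ} (B : Finset (CuspForm 𝒮ℒ (k : ℤ))) : Measure ModularSurface :=
  (((volume : Measure ℍ).restrict 𝒟).withDensity
    (fun z => ENNReal.ofReal (averagedMass B z))).map ModularSurface.proj

/-- A function on `X` is smooth if its pullback to `ℍ` is smooth in the real sense. -/
def ModularSurface.IsSmooth (φ : ModularSurface → ℂ) : Prop :=
  ContMDiff 𝓘(ℝ, ℂ) 𝓘(ℝ, ℂ) ∞ (fun z : ℍ => φ (ModularSurface.proj z))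

end

open scoped ENNReal ComplexConjugate

noncomputable section

/-! Both `averagedMass B` and the constant `3 / π` have integral 1 over `𝒟` (`volume_fd` gives area
`π / 3`), so the difference `u` has mean zero and `∫ |u| = 2 ∫ u⁺`. Hence only an upper bound for
the Bergman kernel on the diagonal is needed; no asymptotic expansion or trace formula enters. The
stated error is then the sup norm of `φ` times this `L¹` distance.

The upper bound is extremal: by `sum_enorm_sq_mul_le_one`, the sum of `|f z|²` over an orthonormal
basis is controlled by any bound for evaluation at `z` against the Petersson norm. Such a bound
comes from the mean value property on a hyperbolic disc of radius about `√(log k / k)`, just large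
enough to give the constant `4π / k` (`peterssonDensity_mul_le_lintegral_sinh`), and from comparing
the disc with `𝒟` by unfolding (`two_mul_lintegral_le_card_mul`). If only `±1` displace `z` by less
than the diameter of the disc, the kernel is at most `k / (4π)`; dividing by a dimension of at least
`k / 12 - 2` gives `3 / π + O(1 / k)`.

With `τ` of order `√(log k / k)`, `small_displacement` shows that below height `1 / (2τ)` this fails
only in a neighbourhood of the unit arc of area `O(τ)`, where finitely many fixed elements intervene
and the averaged mass stays bounded. Above that height the Fourier expansion bounds the whole
averaged mass by `O(τ + 1 / k)` (`sum_lintegral_cuspStrip_le`). These contributions are added in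
`lintegral_averagedMass_sub_le`. -/

/-- The density `y ^ k |f z| ^ 2`, with values in `[0, ∞]`. -/
def peterssonDensity (k : ℕ) (f : ℍ → ℂ) (z : ℍ) : ℝ≥0∞ :=
  ENNReal.ofReal (z.im ^ k * ‖f z‖ ^ 2)

/-! ### The Petersson density and its invariance -/

lemma petersson_self (k : ℕ) (f : ℍ → ℂ) (z : ℍ) :
    petersson (k : ℤ) f f z = ((z.im ^ k * ‖f z‖ ^ 2 : ℝ) : ℂ) := by
  simp only [petersson, zpow_natCast]
  rw [Complex.conj_mul']
  push_cast
  ring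

lemma enorm_petersson_self (k : ℕ) (f : ℍ → ℂ) (z : ℍ) :
    ‖petersson (k : ℤ) f f z‖ₑ = peterssonDensity k f z := by
  rw [petersson_self, peterssonDensity, ← ofReal_norm, Complex.norm_real,
    Real.norm_of_nonneg (by have := z.im_pos; positivity)]

lemma peterssonDensity_eq (k : ℕ) (f : ℍ → ℂ) (z : ℍ) :
    peterssonDensity k f z = ‖f z‖ₑ ^ 2 * ENNReal.ofReal (z.im ^ k) := by
  rw [peterssonDensity, ENNReal.ofReal_mul (pow_nonneg z.im_pos.le _), mul_comm,
    ENNReal.ofReal_pow (norm_nonneg _), ofReal_norm]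

lemma continuous_cuspForm {k : ℤ} (f : CuspForm 𝒮ℒ k) : Continuous f :=
  (CuspFormClass.holo f).continuous

lemma measurable_peterssonDensity (k : ℕ) {f : ℍ → ℂ} (hf : Continuous f) :
    Measurable (peterssonDensity k f) := by
  unfold peterssonDensity
  have : Continuous fun z : ℍ => z.im ^ k * ‖f z‖ ^ 2 :=
    (UpperHalfPlane.continuous_im.pow k).mul (hf.norm.pow 2)
  exact ENNReal.measurable_ofReal.comp this.measurable

lemma peterssonDensity_smul {k : ℕ} (f : CuspForm 𝒮ℒ (k : ℤ)) (γ : SL(2, ℤ)) (z : ℍ) :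
    peterssonDensity k f (γ • z) = peterssonDensity k f z := by
  rw [← enorm_petersson_self, ← enorm_petersson_self]
  have h := SlashInvariantFormClass.norm_petersson_smul (k := (k : ℤ)) (f := f) (f' := f)
    (τ := z) (g := Matrix.SpecialLinearGroup.mapGL ℝ γ) (Γ := 𝒮ℒ) ⟨γ, rfl⟩
  rw [← ofReal_norm, ← ofReal_norm]
  exact congrArg ENNReal.ofReal h

/-! ### Hyperbolic volume in Euclidean coordinates -/

section volume

lemma setLIntegral_upperHalfPlane (S : Set ℍ) (F : ℂ → ℝ≥0∞)
    (hF : Measurable fun z : ℍ => F z) :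
    ∫⁻ z in S, F z = ∫⁻ z in UpperHalfPlane.coe '' S, F z * ENNReal.ofReal ((z.im ^ 2)⁻¹) := by
  have hm : Measurable fun z : ℍ => (((1 / NNReal.mk z.im z.im_pos.le : NNReal) ^ 2 : NNReal) : ℝ≥0∞) := by
    have : Continuous fun z : ℍ => (1 / NNReal.mk z.im z.im_pos.le : NNReal) ^ 2 := by
      refine .pow (.div₀ continuous_const ?_ ?_) _
      · exact UpperHalfPlane.continuous_im.subtype_mk _
      · exact fun x ↦ NNReal.ne_iff.mp x.im_ne_zero
    exact measurable_coe_nnreal_ennreal.comp this.measurable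
  have hmp : MeasurePreserving UpperHalfPlane.coe (volume.comap UpperHalfPlane.coe)
      (volume.restrict (.range UpperHalfPlane.coe)) :=
    ⟨measurable_coe, by rw [measurableEmbedding_coe.map_comap]⟩
  rw [volume_def, restrict_withDensity', lintegral_withDensity_eq_lintegral_mul _ hm hF,
    ← Set.inter_eq_self_of_subset_left (Set.image_subset_range UpperHalfPlane.coe S),
    ← Measure.restrict_restrict' measurableEmbedding_coe.measurableSet_range,
    ← hmp.setLIntegral_comp_emb measurableEmbedding_coe]
  refine lintegral_congr fun z => ?_
  simp only [Pi.mul_apply, mul_comm (F z)]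
  congr 1
  rw [ENNReal.ofReal, ENNReal.coe_inj]
  ext
  simp [Real.coe_toNNReal', sq_nonneg]

lemma lintegral_complex_eq (H : ℂ → ℝ≥0∞) (hH : Measurable H) :
    ∫⁻ z, H z = ∫⁻ x : ℝ, ∫⁻ y : ℝ, H ⟨x, y⟩ := by
  rw [← (Complex.volume_preserving_equiv_real_prod.symm).lintegral_comp hH,
    Measure.volume_eq_prod, lintegral_prod _ (by fun_prop)]
  rfl

end volume

/-! ### Orthonormal bases: Parseval, the extremal bound, and the dimension -/

section bessel

variable {k : ℕ} {B : Finset (CuspForm 𝒮ℒ (k : ℤ))}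

lemma integrable_petersson_self (hB : IsPeterssonOrthonormalBasis B) {f : CuspForm 𝒮ℒ (k : ℤ)}
    (hf : f ∈ B) : IntegrableOn (petersson (k : ℤ) f f) 𝒟 := by
  -- A non-integrable function has integral 0 by convention, contradicting the normalisation to 1,
  -- so no growth estimate for cusp forms is needed.
  by_contra h
  have h1 := hB.inner_self f hf
  rw [peterssonInner, integral_undef h] at h1
  exact zero_ne_one h1

lemma integrable_petersson (hB : IsPeterssonOrthonormalBasis B) {f g : CuspForm 𝒮ℒ (k : ℤ)}
    (hf : f ∈ B) (hg : g ∈ B) : IntegrableOn (petersson (k : ℤ) f g) 𝒟 := by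
  refine ((integrable_petersson_self hB hf).norm.add
    (integrable_petersson_self hB hg).norm).mono'
    (petersson_continuous _ (continuous_cuspForm f) (continuous_cuspForm g)).aestronglyMeasurable
    (Filter.Eventually.of_forall fun z => ?_)
  simp only [petersson, norm_mul, Pi.add_apply, Complex.norm_conj, ← add_mul]
  refine mul_le_mul_of_nonneg_right ?_ (norm_nonneg _)
  nlinarith [sq_nonneg (‖f z‖ - ‖g z‖), norm_nonneg (f z), norm_nonneg (g z)]

lemma lintegral_peterssonDensity_sum (hB : IsPeterssonOrthonormalBasis B)
    (c : CuspForm 𝒮ℒ (k : ℤ) → ℂ) :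
    ∫⁻ z in 𝒟, peterssonDensity k (∑ f ∈ B, c f • f : CuspForm 𝒮ℒ (k : ℤ)) z
      = ∑ f ∈ B, ‖c f‖ₑ ^ 2 := by
  set g := ∑ f ∈ B, c f • f with hg
  have hexp (z : ℍ) : petersson (k : ℤ) g g z
      = ∑ f ∈ B, ∑ f' ∈ B, (conj (c f) * c f') * petersson (k : ℤ) f f' z := by
    have : g z = ∑ f ∈ B, c f * f z := by
      rw [hg]
      have := map_sum (⟨⟨fun f => f z, rfl⟩, fun _ _ => rfl⟩ : CuspForm 𝒮ℒ (k : ℤ) →+ ℂ)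
        (fun f => c f • f) B
      exact this
    simp only [petersson, this, map_sum, Finset.sum_mul, Finset.mul_sum, map_mul]
    rw [Finset.sum_comm]
    refine Finset.sum_congr rfl fun i _ => Finset.sum_congr rfl fun j _ => by ring
  have hint : ∀ f ∈ B, ∀ f' ∈ B, Integrable
      (fun z => (conj (c f) * c f') * petersson (k : ℤ) f f' z) (volume.restrict 𝒟) :=
    fun f hf f' hf' => (integrable_petersson hB hf hf').const_mul _
  have hI : Integrable (petersson (k : ℤ) g g) (volume.restrict 𝒟) := by
    rw [funext hexp]
    exact integrable_finsetSum _ fun f hf => integrable_finsetSum _ fun f' hf' => hint f hf f' hf'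
  have hval : ∫ z in 𝒟, petersson (k : ℤ) g g z = ((∑ f ∈ B, ‖c f‖ ^ 2 : ℝ) : ℂ) := by
    rw [funext hexp, integral_finsetSum _ fun f hf => integrable_finsetSum _ (hint f hf),
      Complex.ofReal_sum]
    refine Finset.sum_congr rfl fun f hf => ?_
    rw [integral_finsetSum _ (hint f hf), Finset.sum_eq_single f]
    · rw [integral_const_mul]
      have := hB.inner_self f hf
      rw [peterssonInner] at this
      rw [this, mul_one, Complex.conj_mul']
      push_cast; rfl
    · intro f' hf' hne
      rw [integral_const_mul]
      have := hB.inner_ne f hf f' hf' hne.symm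
      rw [peterssonInner] at this
      rw [this, mul_zero]
    · exact fun h => absurd hf h
  simp_rw [← enorm_petersson_self]
  rw [← ofReal_integral_norm_eq_lintegral_enorm hI]
  have h2 : ∫ z in 𝒟, ‖petersson (k : ℤ) g g z‖ = ∑ f ∈ B, ‖c f‖ ^ 2 := by
    rw [← Complex.ofReal_inj, ← hval, ← integral_complex_ofReal]
    refine integral_congr_ae (Filter.Eventually.of_forall fun z => ?_)
    simp only [petersson_self, Complex.norm_real]
    rw [Real.norm_of_nonneg (by have := z.im_pos; positivity)]
  rw [h2, ENNReal.ofReal_sum_of_nonneg fun _ _ => by positivity]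
  refine Finset.sum_congr rfl fun f _ => ?_
  rw [ENNReal.ofReal_pow (norm_nonneg _), ofReal_norm]

lemma lintegral_peterssonDensity_of_mem (hB : IsPeterssonOrthonormalBasis B)
    {f : CuspForm 𝒮ℒ (k : ℤ)} (hf : f ∈ B) :
    ∫⁻ z in 𝒟, peterssonDensity k f z = 1 := by
  classical
  have := lintegral_peterssonDensity_sum hB (Pi.single f 1)
  have h1 : (∑ f' ∈ B, (Pi.single f (1 : ℂ) : CuspForm 𝒮ℒ (k : ℤ) → ℂ) f' • f') = f := by
    rw [Finset.sum_eq_single f] <;> simp +contextual [hf]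
  rw [h1] at this
  rw [this, Finset.sum_eq_single f] <;> simp +contextual [hf]

/-- If a functional `ℓ` satisfies `|ℓ g| ^ 2 K ≤ ‖g‖ ^ 2`, then the sum of `|ℓ f| ^ 2` over an
orthonormal basis is at most `K⁻¹`. -/
lemma sum_enorm_sq_mul_le_one (hB : IsPeterssonOrthonormalBasis B)
    (l : CuspForm 𝒮ℒ (k : ℤ) →ₗ[ℂ] ℂ) (K : ℝ≥0∞)
    (hl : ∀ g, ‖l g‖ₑ ^ 2 * K ≤ ∫⁻ z in 𝒟, peterssonDensity k g z) :
    (∑ f ∈ B, ‖l f‖ₑ ^ 2) * K ≤ 1 := by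
  set A := ∑ f ∈ B, ‖l f‖ₑ ^ 2 with hA
  -- The test form is the Riesz representative of `l`: both its squared norm and its value under `l`
  -- equal `A`, so the hypothesis reads `A² K ≤ A`.
  have h := hl (∑ f ∈ B, conj (l f) • f)
  rw [lintegral_peterssonDensity_sum hB (fun f => conj (l f))] at h
  have h1 : ∑ f ∈ B, ‖conj (l f)‖ₑ ^ 2 = A := by
    refine Finset.sum_congr rfl fun f _ => ?_
    rw [← ofReal_norm, Complex.norm_conj, ofReal_norm]
  have h2 : ‖l (∑ f ∈ B, conj (l f) • f)‖ₑ = A := by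
    rw [map_sum]
    have : ∑ f ∈ B, l (conj (l f) • f) = ((∑ f ∈ B, ‖l f‖ ^ 2 : ℝ) : ℂ) := by
      push_cast
      refine Finset.sum_congr rfl fun f _ => ?_
      rw [map_smul, smul_eq_mul, Complex.conj_mul']
    rw [this, ← ofReal_norm, Complex.norm_real,
      Real.norm_of_nonneg (Finset.sum_nonneg fun _ _ => by positivity),
      ENNReal.ofReal_sum_of_nonneg fun _ _ => by positivity]
    refine Finset.sum_congr rfl fun f _ => ?_
    rw [ENNReal.ofReal_pow (norm_nonneg _), ofReal_norm]
  rw [h1, h2] at h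
  have hfin : A ≠ ⊤ := by simp [hA]
  by_cases h0 : A = 0
  · simp [h0]
  · rw [sq, mul_assoc] at h
    calc A * K = A⁻¹ * (A * (A * K)) := by
          rw [← mul_assoc, ENNReal.inv_mul_cancel h0 hfin, one_mul]
      _ ≤ A⁻¹ * A := by gcongr
      _ = 1 := ENNReal.inv_mul_cancel h0 hfin

/-- Spanning alone bounds the cardinality below by the dimension. The loss of 2 covers the
Eisenstein series and the rounding of `k / 12`. -/
lemma card_ge (hB : IsPeterssonOrthonormalBasis B) (hk : 3 ≤ k) (hk2 : Even k) :
    (k : ℝ) / 12 - 2 ≤ B.card := by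
  have h1 := ModularForm.dimension_level_one k hk2
  rw [ModularForm.rank_eq_one_add_rank_cuspForm hk hk2] at h1
  have h2 : Module.rank ℂ (CuspForm 𝒮ℒ (k : ℤ)) ≤ B.card := by
    rw [← rank_top, ← hB.span_eq_top]
    exact rank_span_finset_le B
  have h3 : ((k / 12 : ℕ) : Cardinal) ≤ ((1 + B.card : ℕ) : Cardinal) := by
    calc ((k / 12 : ℕ) : Cardinal) ≤ ((if k ≡ 2 [MOD 12] then k / 12 else k / 12 + 1 : ℕ)) := by
          exact_mod_cast (by split_ifs <;> omega)
      _ = 1 + Module.rank ℂ (CuspForm 𝒮ℒ (k : ℤ)) := h1.symm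
      _ ≤ 1 + B.card := by gcongr
      _ = ((1 + B.card : ℕ) : Cardinal) := by push_cast; rfl
  have h4 : k / 12 ≤ 1 + B.card := by exact_mod_cast h3
  have h5 : k ≤ 12 * (1 + B.card) + 12 := by omega
  have h6 : (k : ℝ) ≤ 12 * (1 + B.card) + 12 := by exact_mod_cast h5
  linarith

end bessel

/-! ### Mean value inequalities on Euclidean discs -/

lemma Complex.det_smul_one (a : ℂ) : (a • (1 : ℂ →L[ℝ] ℂ)).det = ‖a‖ ^ 2 := by
  rw [← Complex.normSq_eq_norm_sq, ← Algebra.norm_complex_apply, Algebra.norm_apply]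
  rfl

/-- The mean value property is applied to the holomorphic function `F²`, followed by the triangle
inequality for the integral. -/
lemma norm_sq_mul_le_lintegral_circle {r : ℝ} (hr : 0 ≤ r) {F : ℂ → ℂ}
    (hF : DiffContOnCl ℂ F (Metric.ball 0 r)) :
    ‖F 0‖ₑ ^ 2 * ENNReal.ofReal (2 * Real.pi)
      ≤ ∫⁻ θ in Set.Ioo (-Real.pi) Real.pi, ‖F (r * (Real.cos θ + Real.sin θ * Complex.I))‖ₑ ^ 2 := by
  have hF2 : DiffContOnCl ℂ (fun z => F z * F z) (Metric.ball 0 |r|) := by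
    rw [abs_of_nonneg hr]
    exact hF.smul hF
  have h1 := hF2.circleAverage
  rw [Real.circleAverage_eq_integral_add (-Real.pi), inv_smul_eq_iff₀ (by positivity)] at h1
  have h2 : ∫ θ in 0..2 * Real.pi, F (circleMap 0 r (θ + -Real.pi)) * F (circleMap 0 r (θ + -Real.pi))
      = ∫ θ in Set.Ioo (-Real.pi) Real.pi, F (circleMap 0 r θ) * F (circleMap 0 r θ) := by
    rw [intervalIntegral.integral_comp_add_right (fun θ => F (circleMap 0 r θ) * F (circleMap 0 r θ)),
      intervalIntegral.integral_of_le (by linarith [Real.pi_pos]), integral_Ioc_eq_integral_Ioo]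
    congr 3 <;> ring
  rw [h2] at h1
  have h3 := enorm_integral_le_lintegral_enorm (μ := volume.restrict (Set.Ioo (-Real.pi) Real.pi))
    (fun θ => F (circleMap 0 r θ) * F (circleMap 0 r θ))
  rw [h1] at h3
  have h4 : ‖(2 * Real.pi) • (F 0 * F 0)‖ₑ = ‖F 0‖ₑ ^ 2 * ENNReal.ofReal (2 * Real.pi) := by
    rw [enorm_smul, Real.enorm_eq_ofReal (by positivity), enorm_mul, sq, mul_comm]
  rw [h4] at h3
  refine h3.trans (le_of_eq ?_)
  refine lintegral_congr fun θ => ?_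
  rw [enorm_mul, sq]
  simp [circleMap, Complex.exp_mul_I]

lemma norm_sq_mul_le_lintegral_ball {t : ℝ} {F : ℂ → ℂ} (hF : DifferentiableOn ℂ F (Metric.ball 0 t))
    {h : ℝ → ℝ} (hc : Continuous h) :
    ‖F 0‖ₑ ^ 2 * ENNReal.ofReal (2 * Real.pi) *
        ∫⁻ r in Set.Ioo 0 t, ENNReal.ofReal r * ENNReal.ofReal (h r)
      ≤ ∫⁻ w in Metric.ball (0 : ℂ) t, ‖F w‖ₑ ^ 2 * ENNReal.ofReal (h ‖w‖) := by
  classical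
  -- `F` is controlled only on the ball, so it is extended by zero to be measurable on the plane
  -- before passing to polar coordinates.
  set q : ℂ → ℝ≥0∞ := (Metric.ball (0 : ℂ) t).indicator
    (fun w => ‖F w‖ₑ ^ 2 * ENNReal.ofReal (h ‖w‖)) with hq
  have hqm : Measurable q := by
    rw [hq, ← Set.piecewise_eq_indicator]
    have hA : Measurable ((Metric.ball (0 : ℂ) t).piecewise F 0) :=
      hF.continuousOn.measurable_piecewise continuousOn_const measurableSet_ball
    have : (Metric.ball (0 : ℂ) t).piecewise (fun w => ‖F w‖ₑ ^ 2 * ENNReal.ofReal (h ‖w‖)) 0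
        = fun w => ‖(Metric.ball (0 : ℂ) t).piecewise F 0 w‖ₑ ^ 2 * ENNReal.ofReal (h ‖w‖) := by
      ext w
      by_cases hw : w ∈ Metric.ball (0 : ℂ) t <;> simp [Set.piecewise, hw]
    rw [this]
    have hc' := hc.measurable
    fun_prop
  rw [← lintegral_indicator measurableSet_ball, ← hq, ← Complex.lintegral_comp_polarCoord_symm,
    polarCoord_target, Measure.volume_eq_prod, ← Measure.prod_restrict,
    lintegral_prod _ (by
      refine Measurable.aemeasurable ?_
      have : Measurable fun p : ℝ × ℝ => (Complex.polarCoord.symm p : ℂ) := by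
        have : Continuous fun p : ℝ × ℝ => (Complex.polarCoord.symm p : ℂ) := by
          simp only [Complex.polarCoord_symm_apply]
          fun_prop
        exact this.measurable
      exact (ENNReal.measurable_ofReal.comp measurable_fst).mul (hqm.comp this))]
  have hsub : Set.Ioo 0 t ⊆ Set.Ioi 0 := fun x hx => hx.1
  refine le_trans ?_ (lintegral_mono_set hsub)
  have hm : Measurable fun r : ℝ => ENNReal.ofReal r * ENNReal.ofReal (h r) := by
    have := hc.measurable
    fun_prop
  rw [← lintegral_const_mul _ hm]
  refine setLIntegral_mono' measurableSet_Ioo fun r hr => ?_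
  have hnorm (θ : ℝ) : ‖((r : ℂ) * (Real.cos θ + Real.sin θ * Complex.I))‖ = r := by
    rw [norm_mul, Complex.norm_real, Real.norm_of_nonneg hr.1.le, Complex.ofReal_cos,
      Complex.ofReal_sin, ← Complex.exp_mul_I, Complex.norm_exp_ofReal_mul_I, mul_one]
  have hmem (θ : ℝ) : (r : ℂ) * (Real.cos θ + Real.sin θ * Complex.I) ∈ Metric.ball (0 : ℂ) t := by
    rw [mem_ball_zero_iff, hnorm]
    exact hr.2
  have hval (θ : ℝ) : ENNReal.ofReal r • q (Complex.polarCoord.symm (r, θ)) =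
      ‖F (r * (Real.cos θ + Real.sin θ * Complex.I))‖ₑ ^ 2 *
        (ENNReal.ofReal r * ENNReal.ofReal (h r)) := by
    rw [Complex.polarCoord_symm_apply, hq, Set.indicator_of_mem (by exact hmem θ)]
    simp only [hnorm, smul_eq_mul]
    ring
  simp_rw [hval]
  rw [lintegral_mul_const']
  · gcongr
    refine norm_sq_mul_le_lintegral_circle hr.1.le ?_
    have hcl : closure (Metric.ball (0 : ℂ) r) ⊆ Metric.ball 0 t :=
      (Metric.closure_ball_subset_closedBall).trans (Metric.closedBall_subset_ball hr.2)
    exact (hF.mono hcl).diffContOnCl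
  · exact ENNReal.mul_ne_top ENNReal.ofReal_ne_top ENNReal.ofReal_ne_top

lemma lintegral_radial (n : ℕ) {t : ℝ} (ht0 : 0 ≤ t) (ht1 : t ≤ 1) :
    ∫⁻ r in Set.Ioo 0 t, ENNReal.ofReal r * ENNReal.ofReal ((1 - r ^ 2) ^ n)
      = ENNReal.ofReal ((1 - (1 - t ^ 2) ^ (n + 1)) / (2 * (n + 1))) := by
  have h1 : ∫⁻ r in Set.Ioo 0 t, ENNReal.ofReal r * ENNReal.ofReal ((1 - r ^ 2) ^ n)
      = ∫⁻ r in Set.Ioo 0 t, ENNReal.ofReal (r * (1 - r ^ 2) ^ n) := by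
    refine setLIntegral_congr_fun measurableSet_Ioo fun r hr => ?_
    exact (ENNReal.ofReal_mul hr.1.le).symm
  have hcont : Continuous fun r : ℝ => r * (1 - r ^ 2) ^ n := by fun_prop
  rw [h1, ← ofReal_integral_eq_lintegral_ofReal
    ((hcont.integrableOn_Icc (a := 0) (b := t)).mono_set Set.Ioo_subset_Icc_self)]
  · rw [← integral_Ioc_eq_integral_Ioo, ← intervalIntegral.integral_of_le ht0]
    rw [intervalIntegral.integral_eq_sub_of_hasDerivAt
      (f := fun r => -((1 - r ^ 2) ^ (n + 1) / (2 * (n + 1))))]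
    · congr 1
      field_simp
      ring
    · intro r _
      have h := ((((hasDerivAt_id r).pow 2).const_sub 1).pow (n + 1)).div_const (2 * ((n : ℝ) + 1))
      refine h.neg.congr_deriv ?_
      simp
      field_simp
    · exact hcont.intervalIntegrable _ _
  · refine (ae_restrict_iff' measurableSet_Ioo).2 (Filter.Eventually.of_forall fun r hr => ?_)
    have : 0 ≤ 1 - r ^ 2 := by nlinarith [hr.1, hr.2]
    have := hr.1.le
    simp only [Pi.zero_apply]
    positivity

/-! ### Transfer to hyperbolic discs by the Cayley transform -/

section submean

/-- This inverts the Cayley transform: `w` is recovered as `(φ - z₀) / (φ - conj z₀)`, which yields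
both injectivity and the image of a centred disc. -/
lemma cayley_sub_sub (z₀ w : ℂ) (hw : 1 - w ≠ 0) :
    (z₀ - conj z₀ * w) / (1 - w) - z₀ = w * ((z₀ - conj z₀ * w) / (1 - w) - conj z₀) := by
  field_simp
  ring

lemma cayley_im (z₀ w : ℂ) :
    ((z₀ - conj z₀ * w) / (1 - w)).im = z₀.im * (1 - ‖w‖ ^ 2) / ‖1 - w‖ ^ 2 := by
  rw [← Complex.normSq_eq_norm_sq, ← Complex.normSq_eq_norm_sq, Complex.div_im]
  simp [Complex.normSq_apply]
  ring

lemma hasDerivAt_cayley (z₀ : ℂ) {w : ℂ} (hw : 1 - w ≠ 0) :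
    HasDerivAt (fun w => (z₀ - conj z₀ * w) / (1 - w)) ((z₀ - conj z₀) / (1 - w) ^ 2) w := by
  have h1 : HasDerivAt (fun w => z₀ - conj z₀ * w) (-conj z₀) w := by
    simpa using ((hasDerivAt_id w).const_mul (conj z₀)).const_sub z₀
  have h2 : HasDerivAt (fun w : ℂ => 1 - w) (-1) w := by
    simpa using (hasDerivAt_id w).const_sub (1 : ℂ)
  refine (h1.div h2 hw).congr_deriv ?_
  congr 1
  ring

lemma one_sub_ne_zero_of_mem_ball {w : ℂ} (hw : w ∈ Metric.ball (0 : ℂ) 1) : 1 - w ≠ 0 := by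
  intro h
  rw [sub_eq_zero] at h
  simp [← h] at hw

lemma cayley_im_pos (z₀ : ℍ) {w : ℂ} (hw : w ∈ Metric.ball (0 : ℂ) 1) :
    0 < (((z₀ : ℂ) - conj (z₀ : ℂ) * w) / (1 - w)).im := by
  rw [cayley_im]
  have h1 : 0 < ‖1 - w‖ := norm_pos_iff.2 (one_sub_ne_zero_of_mem_ball hw)
  have h2 : ‖w‖ < 1 := by simpa using hw
  have h3 : 0 < 1 - ‖w‖ ^ 2 := by nlinarith [norm_nonneg w]
  have := z₀.im_pos
  rw [UpperHalfPlane.coe_im]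
  positivity

/-- The sub-mean value inequality for weight `k = n + 2` on a hyperbolic disc. -/
lemma peterssonDensity_mul_le_lintegral (n : ℕ) {f : ℍ → ℂ} (hf : MDiff f) (z₀ : ℍ) {t : ℝ}
    (ht0 : 0 < t) (ht1 : t < 1) :
    peterssonDensity (n + 2) f z₀ *
        ENNReal.ofReal (4 * Real.pi / (n + 1) * (1 - (1 - t ^ 2) ^ (n + 1)))
      ≤ ∫⁻ z in {z : ℍ | dist (z : ℂ) z₀ < t * dist (z : ℂ) (conj (z₀ : ℂ))},
          peterssonDensity (n + 2) f z := by
  set φ : ℂ → ℂ := fun w => ((z₀ : ℂ) - conj (z₀ : ℂ) * w) / (1 - w) with hφ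
  set S := {z : ℍ | dist (z : ℂ) z₀ < t * dist (z : ℂ) (conj (z₀ : ℂ))} with hS
  have hsub : Metric.ball (0 : ℂ) t ⊆ Metric.ball 0 1 := Metric.ball_subset_ball ht1.le
  have him : ∀ w ∈ Metric.ball (0 : ℂ) t, 0 < (φ w).im := fun w hw => cayley_im_pos z₀ (hsub hw)
  have hy := z₀.im_pos
  have hconj : ∀ w ∈ Metric.ball (0 : ℂ) t, 0 < ‖φ w - conj (z₀ : ℂ)‖ := by
    intro w hw
    rw [norm_pos_iff, sub_ne_zero]
    intro h
    have := him w hw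
    rw [h, Complex.conj_im, UpperHalfPlane.coe_im] at this
    linarith
  have hinj : Set.InjOn φ (Metric.ball 0 t) := by
    intro w hw w' hw' h
    have h1 := cayley_sub_sub z₀ w (one_sub_ne_zero_of_mem_ball (hsub hw))
    have h2 := cayley_sub_sub z₀ w' (one_sub_ne_zero_of_mem_ball (hsub hw'))
    change φ w - _ = w * (φ w - _) at h1
    change φ w' - _ = w' * (φ w' - _) at h2
    rw [← h, h1] at h2
    exact mul_right_cancel₀ (norm_pos_iff.1 (hconj w hw)) h2
  have himg : φ '' Metric.ball 0 t ⊆ UpperHalfPlane.coe '' S := by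
    rintro _ ⟨w, hw, rfl⟩
    refine ⟨⟨φ w, him w hw⟩, ?_, rfl⟩
    have h1 := cayley_sub_sub z₀ w (one_sub_ne_zero_of_mem_ball (hsub hw))
    change φ w - _ = w * (φ w - _) at h1
    rw [hS, Set.mem_ofPred_eq, dist_eq_norm, dist_eq_norm]
    change ‖φ w - _‖ < t * ‖φ w - _‖
    rw [h1, norm_mul]
    exact mul_lt_mul_of_pos_right (by simpa using hw) (hconj w hw)
  -- Dividing by the weight `n + 2` automorphy factor of the Cayley transform turns the density into
  -- `|F|² (1 - |w|²) ^ n` up to a constant; the hyperbolic measure lowers the exponent by 2.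
  set F : ℂ → ℂ := fun w => (f ∘ ofComplex) (φ w) / (1 - w) ^ (n + 2) with hF
  have hFd : DifferentiableOn ℂ F (Metric.ball 0 t) := by
    have h1 : DifferentiableOn ℂ φ (Metric.ball 0 t) := fun w hw =>
      (hasDerivAt_cayley z₀
        (one_sub_ne_zero_of_mem_ball (hsub hw))).differentiableAt.differentiableWithinAt
    refine ((UpperHalfPlane.mdifferentiable_iff.1 hf).comp h1 him).div (by fun_prop) fun w hw => ?_
    exact pow_ne_zero _ (one_sub_ne_zero_of_mem_ball (hsub hw))
  have hden : peterssonDensity (n + 2) f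
      = fun z : ℍ => peterssonDensity (n + 2) f (ofComplex z) := by
    ext z; rw [ofComplex_apply]
  have hmeas : Measurable fun z : ℍ => peterssonDensity (n + 2) f (ofComplex z) := by
    rw [← hden]; exact measurable_peterssonDensity _ hf.continuous
  have hpt : ∀ w ∈ Metric.ball (0 : ℂ) t,
      ENNReal.ofReal |((((z₀ : ℂ) - conj (z₀ : ℂ)) / (1 - w) ^ 2) • (1 : ℂ →L[ℝ] ℂ)).det| *
        (peterssonDensity (n + 2) f (ofComplex (φ w)) * ENNReal.ofReal (((φ w).im ^ 2)⁻¹))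
      = ‖F w‖ₑ ^ 2 * ENNReal.ofReal ((1 - ‖w‖ ^ 2) ^ n)
          * ENNReal.ofReal (4 * z₀.im ^ (n + 2)) := by
    intro w hw
    have hw1 : 0 < ‖1 - w‖ := norm_pos_iff.2 (one_sub_ne_zero_of_mem_ball (hsub hw))
    have hw2 : ‖w‖ < 1 := by simpa using hsub hw
    have hw3 : 0 < 1 - ‖w‖ ^ 2 := by nlinarith [norm_nonneg w]
    have hpos := him w hw
    have himw : (φ w).im = z₀.im * (1 - ‖w‖ ^ 2) / ‖1 - w‖ ^ 2 := cayley_im z₀ w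
    rw [peterssonDensity, Complex.det_smul_one, abs_of_nonneg (by positivity),
      ← ENNReal.ofReal_mul' (by positivity), ← ENNReal.ofReal_mul (by positivity),
      ← ofReal_norm, ← ENNReal.ofReal_pow (norm_nonneg _), ← ENNReal.ofReal_mul (by positivity),
      ← ENNReal.ofReal_mul (by positivity)]
    congr 1
    have e1 : ‖((z₀ : ℂ) - conj (z₀ : ℂ)) / (1 - w) ^ 2‖ = 2 * z₀.im / ‖1 - w‖ ^ 2 := by
      rw [norm_div, norm_pow, Complex.sub_conj]
      simp [abs_of_pos hy]
    have e2 : (ofComplex (φ w)).im = (φ w).im := by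
      rw [ofComplex_apply_of_im_pos hpos]; rfl
    have e3 : ‖F w‖ = ‖f (ofComplex (φ w))‖ / ‖1 - w‖ ^ (n + 2) := by
      rw [hF]; simp
    rw [e1, e2, e3, himw]
    generalize ‖f (ofComplex (φ w))‖ = u
    generalize ‖1 - w‖ = a at hw1 ⊢
    generalize 1 - ‖w‖ ^ 2 = b at hw3 ⊢
    simp only [div_pow, mul_pow, ← pow_mul]
    field_simp
    ring
  have hF0 : ‖F 0‖ₑ ^ 2 * ENNReal.ofReal (z₀.im ^ (n + 2)) = peterssonDensity (n + 2) f z₀ := by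
    rw [peterssonDensity_eq]
    simp [hF, hφ]
  calc _ = ‖F 0‖ₑ ^ 2 * ENNReal.ofReal (2 * Real.pi) *
        (∫⁻ r in Set.Ioo 0 t, ENNReal.ofReal r * ENNReal.ofReal ((1 - r ^ 2) ^ n))
          * ENNReal.ofReal (4 * z₀.im ^ (n + 2)) := by
        rw [lintegral_radial n ht0.le ht1.le, ← hF0]
        have h1 : (1 - t ^ 2) ^ (n + 1) ≤ 1 := pow_le_one₀ (by nlinarith) (by nlinarith)
        have h2 : 0 ≤ 1 - (1 - t ^ 2) ^ (n + 1) := by linarith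
        rw [mul_assoc, mul_assoc, mul_assoc, ← ENNReal.ofReal_mul (by positivity),
          ← ENNReal.ofReal_mul (by positivity), ← ENNReal.ofReal_mul (by positivity)]
        congr 2
        field_simp
    _ ≤ (∫⁻ w in Metric.ball (0 : ℂ) t, ‖F w‖ₑ ^ 2 * ENNReal.ofReal ((1 - ‖w‖ ^ 2) ^ n))
          * ENNReal.ofReal (4 * z₀.im ^ (n + 2)) := by
        gcongr
        exact norm_sq_mul_le_lintegral_ball hFd (h := fun r => (1 - r ^ 2) ^ n) (by fun_prop)
    _ = ∫⁻ z in φ '' Metric.ball 0 t,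
          peterssonDensity (n + 2) f (ofComplex z) * ENNReal.ofReal ((z.im ^ 2)⁻¹) := by
        rw [lintegral_image_eq_lintegral_abs_det_fderiv_mul volume measurableSet_ball
          (fun w hw => ((hasDerivAt_cayley z₀ (one_sub_ne_zero_of_mem_ball
            (hsub hw))).complexToReal_fderiv).hasFDerivWithinAt) hinj,
          setLIntegral_congr_fun measurableSet_ball hpt,
          lintegral_mul_const' _ _ ENNReal.ofReal_ne_top]
    _ ≤ ∫⁻ z in UpperHalfPlane.coe '' S,
          peterssonDensity (n + 2) f (ofComplex z) * ENNReal.ofReal ((z.im ^ 2)⁻¹) :=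
        lintegral_mono_set himg
    _ = ∫⁻ z in S, peterssonDensity (n + 2) f z := by
        conv_rhs => rw [hden]
        exact (setLIntegral_upperHalfPlane S
          (fun z => peterssonDensity (n + 2) f (ofComplex z)) hmeas).symm

/-- The quotient of the two Euclidean distances is `tanh (d / 2)`, and `s / √(1 + s²)` is the
hyperbolic tangent of the number whose `sinh` is `s`. -/
lemma sinh_half_dist_lt_of_dist_lt {z w : ℍ} {s : ℝ} (hs : 0 < s)
    (h : dist (z : ℂ) w < s / √(1 + s ^ 2) * dist (z : ℂ) (conj (w : ℂ))) :
    Real.sinh (dist z w / 2) < s := by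
  have hd : 0 < dist (z : ℂ) (conj (w : ℂ)) := by
    rw [dist_pos]
    intro h'
    have h1 := z.im_pos
    have h2 := w.im_pos
    have h3 := congrArg Complex.im h'
    rw [Complex.conj_im, UpperHalfPlane.coe_im, UpperHalfPlane.coe_im] at h3
    linarith
  rw [← div_lt_iff₀ hd, ← tanh_half_dist, Real.tanh_eq_sinh_div_cosh,
    ← Real.sqrt_sq (Real.cosh_pos (dist z w / 2)).le, Real.cosh_sq'] at h
  set u := Real.sinh (dist z w / 2)
  have hu : 0 ≤ u := Real.sinh_nonneg_iff.2 (by positivity)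
  have h1 : 0 < √(1 + u ^ 2) := Real.sqrt_pos.2 (by positivity)
  have h2 : 0 < √(1 + s ^ 2) := Real.sqrt_pos.2 (by positivity)
  rw [div_lt_div_iff₀ h1 h2] at h
  have h3 := pow_lt_pow_left₀ h (by positivity) two_ne_zero
  rw [mul_pow, mul_pow, Real.sq_sqrt (by positivity), Real.sq_sqrt (by positivity)] at h3
  exact lt_of_pow_lt_pow_left₀ 2 hs.le (by nlinarith)

/-- The sub-mean value inequality with an optimal constant `4 π / k`. -/
lemma peterssonDensity_mul_le_lintegral_sinh {k : ℕ} (hk : 2 ≤ k) {f : ℍ → ℂ} (hf : MDiff f)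
    (z₀ : ℍ) {s : ℝ} (hs : 0 < s) (hsk : k ≤ (1 + s ^ 2) ^ (k - 1)) :
    peterssonDensity k f z₀ * ENNReal.ofReal (4 * Real.pi / k)
      ≤ ∫⁻ z in {z : ℍ | Real.sinh (dist z z₀ / 2) < s}, peterssonDensity k f z := by
  obtain ⟨n, rfl⟩ : ∃ n, k = n + 2 := ⟨k - 2, by omega⟩
  have h2 : 0 < √(1 + s ^ 2) := Real.sqrt_pos.2 (by positivity)
  have ht1 : s / √(1 + s ^ 2) < 1 := by
    rw [div_lt_one h2]
    exact Real.lt_sqrt_of_sq_lt (by linarith)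
  have h := peterssonDensity_mul_le_lintegral n hf z₀ (div_pos hs h2) ht1
  refine le_trans ?_ (h.trans (lintegral_mono_set fun z hz => sinh_half_dist_lt_of_dist_lt hs hz))
  gcongr
  have e : 1 - (s / √(1 + s ^ 2)) ^ 2 = (1 + s ^ 2)⁻¹ := by
    rw [div_pow, Real.sq_sqrt (by positivity)]
    field_simp
    ring
  rw [e, inv_pow]
  -- The part of the mass lost outside the disc is at most `1 / k`, and `(1 - 1 / k) / (k - 1) = 1 /
  -- k` makes the constant exactly `4π / k`.
  have h3 : ((1 + s ^ 2) ^ (n + 1))⁻¹ ≤ ((n + 2 : ℕ) : ℝ)⁻¹ := by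
    refine inv_anti₀ (by positivity) ?_
    simpa using hsk
  have h4 : 4 * Real.pi / ((n + 2 : ℕ) : ℝ) = 4 * Real.pi / (n + 1) * (1 - ((n + 2 : ℕ) : ℝ)⁻¹) := by
    push_cast
    field_simp
    ring
  rw [h4]
  gcongr

end submean

/-! ### Elements of the modular group with small displacement -/

section displacement

lemma norm_lt_of_sinh_half_dist_smul_lt (γ : SL(2, ℤ)) (z : ℍ) {τ : ℝ}
    (h : Real.sinh (dist z (γ • z) / 2) < τ) :
    ‖(γ 1 0 : ℂ) * z ^ 2 + ((γ 1 1 : ℂ) - γ 0 0) * z - γ 0 1‖ < 2 * τ * z.im := by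
  have hy := z.im_pos
  have hD : (γ 1 0 : ℂ) * z + γ 1 1 ≠ 0 := by
    simpa [ModularGroup.denom_apply] using UpperHalfPlane.denom_ne_zero γ z
  have hN : 0 < ‖(γ 1 0 : ℂ) * z + γ 1 1‖ := norm_pos_iff.2 hD
  have him : (γ • z).im = z.im / ‖(γ 1 0 : ℂ) * z + γ 1 1‖ ^ 2 := by
    rw [ModularGroup.im_smul_eq_div_normSq, ModularGroup.denom_apply, Complex.normSq_eq_norm_sq]
  have hcoe : ((γ • z : ℍ) : ℂ) = ((γ 0 0 : ℂ) * z + γ 0 1) / ((γ 1 0 : ℂ) * z + γ 1 1) := by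
    rw [UpperHalfPlane.specialLinearGroup_apply]
    simp
  rw [sinh_half_dist, him, hcoe, dist_eq_norm] at h
  have e1 : √(z.im * (z.im / ‖(γ 1 0 : ℂ) * z + γ 1 1‖ ^ 2))
      = z.im / ‖(γ 1 0 : ℂ) * z + γ 1 1‖ := by
    rw [← mul_div_assoc, ← sq, ← div_pow, Real.sqrt_sq (by positivity)]
  have e2 : (z : ℂ) - ((γ 0 0 : ℂ) * z + γ 0 1) / ((γ 1 0 : ℂ) * z + γ 1 1)
      = ((γ 1 0 : ℂ) * z ^ 2 + ((γ 1 1 : ℂ) - γ 0 0) * z - γ 0 1)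
        / ((γ 1 0 : ℂ) * z + γ 1 1) := by
    rw [eq_div_iff hD, sub_mul, div_mul_cancel₀ _ hD]
    ring
  rw [e1, e2, norm_div, div_lt_iff₀ (by positivity)] at h
  have h' := mul_lt_mul_of_pos_right h hN
  rw [div_mul_cancel₀ _ hN.ne'] at h'
  refine h'.trans_eq ?_
  field_simp

/-- The last two hypotheses bound the imaginary and real parts of `c z² + (d - a) z - b`. If `c =
0`, then `a = d` and the height condition forces the integer `b` to vanish. If `c ≠ 0`, the
determinant and `(a + d)² ≥ 0` force `|c| y` to be at most about 1; as `y ≥ 0.86` on `𝒟`, this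
leaves `|c| = 1`. Then `b ≈ -c |z|²` with `|z|²` between 1 and less than 2 gives `b = -c`, so `ad =
0` and `|z|²` is near 1. -/
lemma small_displacement_aux {a b c d : ℤ} (hdet : a * d - b * c = 1) {x y τ : ℝ}
    (hx : |x| ≤ 1 / 2) (hxy : 1 ≤ x ^ 2 + y ^ 2) (hy : 0 < y) (hτ : τ ≤ 1 / 100)
    (hτy : 2 * τ * y ≤ 1)
    (h1 : |c * (2 * x * y) + (d - a) * y| < 2 * τ * y)
    (h2 : |c * (x ^ 2 - y ^ 2) + (d - a) * x - b| < 2 * τ * y) :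
    (c = 0 ∧ b = 0) ∨ ((|a| ≤ 1 ∧ |b| ≤ 1 ∧ |c| ≤ 1 ∧ |d| ≤ 1) ∧ x ^ 2 + y ^ 2 ≤ 1 + 5 * τ) := by
  have hx' := abs_le.1 hx
  have hy1 : 86 / 100 ≤ y := by nlinarith
  have hs : |2 * c * x + d - a| < 2 * τ := by
    rw [show (c : ℝ) * (2 * x * y) + (d - a) * y = (2 * c * x + d - a) * y by ring, abs_mul,
      abs_of_pos hy] at h1
    exact lt_of_mul_lt_mul_right h1 hy.le
  have hτ0 : 0 < τ := by
    have := (abs_nonneg _).trans_lt hs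
    linarith
  have hs' := abs_lt.1 hs
  have h2' := abs_lt.1 h2
  set s := 2 * c * x + d - a with hsdef
  have he : |c * (x ^ 2 + y ^ 2) + b| < 4 * τ * y := by
    have e : c * (x ^ 2 + y ^ 2) + b
        = x * s - (c * (x ^ 2 - y ^ 2) + (d - a) * x - b) := by rw [hsdef]; ring
    have hxs : |x * s| ≤ 1 / 2 * (2 * τ) := by
      rw [abs_mul]
      exact mul_le_mul hx hs.le (abs_nonneg _) (by norm_num)
    have hxs' := abs_le.1 hxs
    rw [e, abs_lt]
    constructor <;> nlinarith
  by_cases hc : c = 0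
  · left
    refine ⟨hc, ?_⟩
    subst hc
    simp only [zero_mul, mul_zero, sub_zero, Int.cast_zero, zero_add] at hdet h2 hs hs' h2' hsdef
    have had : a = d := by
      rcases Int.eq_one_or_neg_one_of_mul_eq_one' hdet with h | h <;> omega
    have h3 : |(b : ℝ)| < 1 := by
      rw [had, sub_self, zero_mul, zero_sub, abs_neg] at h2
      exact h2.trans_le hτy
    exact Int.abs_lt_one_iff.1 (by exact_mod_cast h3)
  · right
    have hdetR : (a : ℝ) * d - b * c = 1 := by exact_mod_cast hdet
    have hc1 : (1 : ℝ) ≤ |(c : ℝ)| := by exact_mod_cast Int.one_le_abs hc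
    set q := |(c : ℝ)| * y with hq
    have hq0 : 86 / 100 ≤ q := by nlinarith
    obtain ⟨e, he', hee⟩ : ∃ e : ℝ, |e| < 4 * τ * y ∧ (b : ℝ) = e - c * (x ^ 2 + y ^ 2) :=
      ⟨_, he, by ring⟩
    have hq2 : q ^ 2 = c ^ 2 * y ^ 2 := by rw [hq, mul_pow, sq_abs]
    have htr : (0 : ℝ) ≤ (a + d) ^ 2 := sq_nonneg _
    -- This is the discriminant identity `(a + d)² = 4 + (d - a)² + 4bc`, with `b` and `d - a`
    -- replaced by their approximate values plus the errors `e` and `s`.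
    have hid : ((a : ℝ) + d) ^ 2 = 4 - 4 * q ^ 2 - 4 * (c * x) * s + s ^ 2 + 4 * (c * e) := by
      have hd : (d : ℝ) = s - 2 * c * x + a := by rw [hsdef]; ring
      rw [hee] at hdetR
      rw [hq2]
      rw [hd] at hdetR ⊢
      linear_combination 4 * hdetR
    have b1 : |(c : ℝ) * x * s| ≤ 2 * τ * q := by
      rw [abs_mul, abs_mul]
      calc |(c : ℝ)| * |x| * |s| ≤ |(c : ℝ)| * (1 / 2) * (2 * τ) := by gcongr
        _ = |(c : ℝ)| * τ := by ring
        _ ≤ _ := by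
          have : 0 ≤ |(c : ℝ)| * τ * (2 * y - 1) := mul_nonneg (by positivity) (by linarith)
          rw [hq]
          linarith
    have b2 : |(c : ℝ) * e| ≤ 4 * τ * q := by
      rw [abs_mul, hq]
      calc |(c : ℝ)| * |e| ≤ |(c : ℝ)| * (4 * τ * y) := by gcongr
        _ = _ := by ring
    have b3 : s ^ 2 ≤ (2 * τ) ^ 2 := sq_le_sq' hs'.1.le hs'.2.le
    have b1' := abs_le.1 b1
    have b2' := abs_le.1 b2
    have hq1 : q ≤ 107 / 100 := by
      have t1 : τ * q ≤ 1 / 100 * q := mul_le_mul_of_nonneg_right hτ (by linarith)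
      have t2 : τ ^ 2 ≤ (1 / 100) ^ 2 := pow_le_pow_left₀ hτ0.le hτ 2
      by_contra! hlt
      have t3 : 107 / 100 * q ≤ q ^ 2 := by
        rw [sq]
        exact mul_le_mul_of_nonneg_right hlt.le (by linarith)
      linarith
    have hcle : |(c : ℝ)| < 2 := by
      by_contra! h2c
      have : 2 * y ≤ q := mul_le_mul_of_nonneg_right h2c hy.le
      linarith
    have hcz : |c| = 1 := by
      have : |c| < 2 := by exact_mod_cast hcle
      have := Int.one_le_abs hc
      omega
    have hcr : |(c : ℝ)| = 1 := by exact_mod_cast hcz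
    have hyle : y ≤ 107 / 100 := by rw [hq, hcr, one_mul] at hq1; exact hq1
    have hx2 : x ^ 2 ≤ 1 / 4 := by nlinarith
    have hy2 : y ^ 2 ≤ (107 / 100) ^ 2 := pow_le_pow_left₀ hy.le hyle 2
    have hty : τ * y ≤ τ * (107 / 100) := mul_le_mul_of_nonneg_left hyle hτ0.le
    have he'' := abs_lt.1 he'
    have hc2 : c = 1 ∨ c = -1 := by
      rcases abs_choice c with h | h <;> omega
    have hb : b = -c := by
      rcases hc2 with rfl | rfl
      · have l1 : (-2 : ℝ) < b := by rw [hee]; push_cast; linarith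
        have l2 : (b : ℝ) < 0 := by rw [hee]; push_cast; linarith
        have l1' : -2 < b := by exact_mod_cast l1
        have l2' : b < 0 := by exact_mod_cast l2
        omega
      · have l1 : (0 : ℝ) < b := by rw [hee]; push_cast; linarith
        have l2 : (b : ℝ) < 2 := by rw [hee]; push_cast; linarith
        have l1' : 0 < b := by exact_mod_cast l1
        have l2' : b < 2 := by exact_mod_cast l2
        omega
    have hbc : b * c = -1 := by rcases hc2 with rfl | rfl <;> simp [hb]
    have had : a * d = 0 := by omega
    have hda : |(d : ℝ) - a| < 2 := by
      have h3 : |(c : ℝ) * x| ≤ 1 / 2 := by rw [abs_mul, hcr, one_mul]; exact hx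
      have h3' := abs_le.1 h3
      rw [abs_lt]
      constructor <;> linarith
    have hda' : |d - a| < 2 := by exact_mod_cast hda
    have hda2 := abs_lt.1 hda'
    constructor
    · have hb1 : |b| = 1 := by rw [hb, abs_neg, hcz]
      refine ⟨?_, hb1.le, hcz.le, ?_⟩
      all_goals
        rw [abs_le]
        rcases mul_eq_zero.1 had with h | h <;> constructor <;> omega
    -- With `b = -c = ∓1`, `|z|² - 1` equals `e` up to sign, and `|e| < 4τy ≤ 4.28τ`.
    · rcases hc2 with rfl | rfl
      · rw [hb] at hee; push_cast at hee; linarith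
      · rw [hb] at hee; push_cast at hee; linarith

/-- Exceptional elements come from a finite set independent of `z` and `τ`, and occur only near the
unit arc, where the elliptic points of `𝒟` lie. -/
lemma small_displacement (γ : SL(2, ℤ)) {z : ℍ} (hz : z ∈ 𝒟) {τ : ℝ} (hτ : τ ≤ 1 / 100)
    (hτy : 2 * τ * z.im ≤ 1) (h : Real.sinh (dist z (γ • z) / 2) < τ) :
    (γ = 1 ∨ γ = -1) ∨ ((∀ i j, |γ i j| ≤ 1) ∧ Complex.normSq z ≤ 1 + 5 * τ) := by
  have h0 := norm_lt_of_sinh_half_dist_smul_lt γ z h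
  have hre := (Complex.abs_re_le_norm _).trans_lt h0
  have him := (Complex.abs_im_le_norm _).trans_lt h0
  have e1 : ((γ 1 0 : ℂ) * z ^ 2 + ((γ 1 1 : ℂ) - γ 0 0) * z - γ 0 1).re
      = γ 1 0 * (z.re ^ 2 - z.im ^ 2) + (γ 1 1 - γ 0 0) * z.re - γ 0 1 := by
    simp [sq]
  have e2 : ((γ 1 0 : ℂ) * z ^ 2 + ((γ 1 1 : ℂ) - γ 0 0) * z - γ 0 1).im
      = γ 1 0 * (2 * z.re * z.im) + (γ 1 1 - γ 0 0) * z.im := by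
    simp only [sq, Complex.sub_im, Complex.add_im, Complex.mul_im, Complex.mul_re, Complex.sub_re,
      Complex.intCast_re, Complex.intCast_im, UpperHalfPlane.coe_re, UpperHalfPlane.coe_im]
    ring
  rw [e1] at hre
  rw [e2] at him
  have hdet : γ 0 0 * γ 1 1 - γ 0 1 * γ 1 0 = 1 := by
    rw [← Matrix.det_fin_two, γ.det_coe]
  have hn : Complex.normSq z = z.re ^ 2 + z.im ^ 2 := by
    rw [Complex.normSq_apply, UpperHalfPlane.coe_re, UpperHalfPlane.coe_im]; ring
  have hz1 := hz.1
  rw [hn] at hz1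
  rcases small_displacement_aux hdet hz.2 hz1 z.im_pos hτ hτy him hre with ⟨hc, hb⟩ | ⟨⟨h1, h2, h3, h4⟩, h5⟩
  · left
    rw [hb, zero_mul, sub_zero] at hdet
    rcases Int.eq_one_or_neg_one_of_mul_eq_one' hdet with h | h
    · left
      ext i j
      fin_cases i <;> fin_cases j <;> simp [h, hb, hc]
    · right
      ext i j
      fin_cases i <;> fin_cases j <;> simp [h, hb, hc]
  · right
    refine ⟨fun i j => ?_, hn ▸ h5⟩
    fin_cases i <;> fin_cases j <;> assumption

lemma finite_entries_le_one : {γ : SL(2, ℤ) | ∀ i j, |γ i j| ≤ 1}.Finite := by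
  refine Set.Finite.of_finite_image (f := fun γ : SL(2, ℤ) => (γ : Matrix (Fin 2) (Fin 2) ℤ))
    (Set.Finite.subset (Set.Finite.pi' fun _ : Fin 2 => Set.Finite.pi' fun _ : Fin 2 =>
      Set.finite_Icc (-1 : ℤ) 1) ?_) Subtype.val_injective.injOn
  rintro _ ⟨γ, hγ, rfl⟩ i j
  exact Set.mem_Icc.2 (abs_le.1 (hγ i j))

end displacement

/-! ### Unfolding and the pointwise kernel bound -/

section unfolding

instance countable_SL_two_int : Countable SL(2, ℤ) :=
  Function.Injective.countable (f := fun (γ : SL(2, ℤ)) (i j : Fin 2) => γ i j)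
    fun _ _ h => Subtype.ext (Matrix.ext fun i j => congrFun (congrFun h i) j)

lemma measurePreserving_smul_SL (γ : SL(2, ℤ)) :
    MeasurePreserving (fun z : ℍ => γ • z) volume volume :=
  measurePreserving_smul (Matrix.SpecialLinearGroup.mapGL ℝ γ : GL (Fin 2) ℝ) (volume : Measure ℍ)

lemma dist_smul_SL (γ : SL(2, ℤ)) (z w : ℍ) : dist (γ • z) (γ • w) = dist z w :=
  dist_smul (Matrix.SpecialLinearGroup.map (Int.castRingHom ℝ) γ : SL(2, ℝ)) z w

lemma sinh_half_dist_lt {z u v : ℍ} {s : ℝ} (hu : Real.sinh (dist u z / 2) < s)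
    (hv : Real.sinh (dist v z / 2) < s) :
    Real.sinh ((dist u z + dist v z) / 2) < 2 * s * √(1 + s ^ 2) := by
  have hc : ∀ w : ℍ, Real.sinh (dist w z / 2) < s →
      0 ≤ Real.sinh (dist w z / 2) ∧ 0 < Real.cosh (dist w z / 2) ∧
        Real.cosh (dist w z / 2) ≤ √(1 + s ^ 2) := by
    intro w hw
    have h0 : 0 ≤ Real.sinh (dist w z / 2) := Real.sinh_nonneg_iff.2 (by positivity)
    refine ⟨h0, Real.cosh_pos _, Real.le_sqrt_of_sq_le ?_⟩
    rw [Real.cosh_sq']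
    nlinarith
  obtain ⟨hu0, hu1, hu2⟩ := hc u hu
  obtain ⟨hv0, hv1, hv2⟩ := hc v hv
  have hs : 0 < √(1 + s ^ 2) := hu1.trans_le hu2
  rw [add_div, Real.sinh_add]
  calc _ ≤ Real.sinh (dist u z / 2) * √(1 + s ^ 2) + √(1 + s ^ 2) * Real.sinh (dist v z / 2) := by
        gcongr
    _ < s * √(1 + s ^ 2) + √(1 + s ^ 2) * s := by gcongr
    _ = _ := by ring

/-- Unfolding: the integral of an invariant function over a hyperbolic ball is bounded by its
integral over the fundamental domain, times the number of elements of `SL(2, ℤ)` that displace the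
centre by less than the diameter. -/
lemma two_mul_lintegral_le_card_mul {G : ℍ → ℝ≥0∞} (hG : Measurable G)
    (hinv : ∀ (γ : SL(2, ℤ)) z, G (γ • z) = G z) (z : ℍ) (s : ℝ) (T : Finset SL(2, ℤ))
    (hT : ∀ γ : SL(2, ℤ), Real.sinh (dist z (γ • z) / 2) < 2 * s * √(1 + s ^ 2) → γ ∈ T) :
    2 * ∫⁻ w in {w : ℍ | Real.sinh (dist w z / 2) < s}, G w ≤ T.card * ∫⁻ w in 𝒟, G w := by
  classical
  set S := {w : ℍ | Real.sinh (dist w z / 2) < s} with hS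
  have hSm : MeasurableSet S :=
    (isOpen_lt (by have := Real.continuous_sinh; fun_prop) continuous_const).measurableSet
  have hDm : MeasurableSet 𝒟 := ModularGroup.isClosed_fd.measurableSet
  have hsm (γ : SL(2, ℤ)) : Measurable fun w : ℍ => γ • w := (measurePreserving_smul_SL γ).measurable
  have hcard (w : ℍ) : ∑' γ : SL(2, ℤ), S.indicator (1 : ℍ → ℝ≥0∞) (γ⁻¹ • w) ≤ T.card := by
    by_cases h : ∃ γ₀ : SL(2, ℤ), γ₀⁻¹ • w ∈ S
    · obtain ⟨γ₀, h₀⟩ := h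
      -- Once one translate `γ₀⁻¹ • w` lies in the disc, any other differs from it by an element
      -- moving the centre by less than the diameter, hence by an element of `T`.
      rw [tsum_eq_sum (s := T.image fun δ => γ₀ * δ⁻¹)]
      · calc _ ≤ ∑ γ ∈ T.image fun δ => γ₀ * δ⁻¹, (1 : ℝ≥0∞) :=
              Finset.sum_le_sum fun γ _ =>
                Set.indicator_le_self' (f := (1 : ℍ → ℝ≥0∞)) (by simp) (γ⁻¹ • w)
          _ = ((T.image fun δ => γ₀ * δ⁻¹).card : ℝ≥0∞) := by simp
          _ ≤ T.card := by exact_mod_cast Finset.card_image_le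
      · intro γ hγ
        rw [Set.indicator_of_notMem]
        intro hmem
        refine hγ (Finset.mem_image.2 ⟨γ⁻¹ * γ₀, hT _ ?_, by group⟩)
        refine lt_of_le_of_lt (Real.sinh_le_sinh.2 ?_) (sinh_half_dist_lt hmem h₀)
        have e : (γ⁻¹ * γ₀) • (γ₀⁻¹ • w) = γ⁻¹ • w := by
          rw [smul_smul]
          congr 1
          group
        have h1 := dist_triangle z (γ⁻¹ • w) ((γ⁻¹ * γ₀) • z)
        have h2 : dist (γ⁻¹ • w) ((γ⁻¹ * γ₀) • z) = dist (γ₀⁻¹ • w) z := by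
          rw [← e, dist_smul_SL]
        rw [h2, dist_comm z (γ⁻¹ • w)] at h1
        linarith
    · push Not at h
      rw [ENNReal.tsum_eq_zero.2 fun γ => Set.indicator_of_notMem (h γ) _]
      exact zero_le
  -- The factor 2 arises because `γ` and `-γ` are distinct but act identically. Only a lower bound
  -- on the number of translates is used, so overlaps on the boundary of `𝒟` are harmless.
  have hcover (w : ℍ) : 2 * S.indicator G w
      ≤ ∑' γ : SL(2, ℤ), S.indicator 1 w * Set.indicator 𝒟 G (γ • w) := by
    by_cases hw : w ∈ S
    · obtain ⟨γ, hγ⟩ := ModularGroup.exists_smul_mem_fd w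
      have hne : γ ≠ -γ := by
        intro h
        have h1 := congrArg (fun δ : SL(2, ℤ) => (δ : Matrix (Fin 2) (Fin 2) ℤ)) h
        have h0 : (γ : Matrix (Fin 2) (Fin 2) ℤ) = 0 := by
          ext i j
          have := congrFun (congrFun h1 i) j
          simp at this ⊢
          omega
        have := γ.det_coe
        simp [h0] at this
      refine le_trans (le_of_eq ?_) (ENNReal.sum_le_tsum {γ, -γ})
      have hneg : (-γ) • w = γ • w := by simp
      rw [Finset.sum_pair hne, hneg, Set.indicator_of_mem hw, Set.indicator_of_mem hw,
        Set.indicator_of_mem hγ, hinv, two_mul]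
      simp
    · simp [Set.indicator_of_notMem hw]
  have hm1 (γ : SL(2, ℤ)) : Measurable fun w : ℍ => S.indicator (1 : ℍ → ℝ≥0∞) (γ • w) :=
    (measurable_one.indicator hSm).comp (hsm γ)
  have hm2 (γ : SL(2, ℤ)) : Measurable fun w : ℍ => Set.indicator 𝒟 G (γ • w) :=
    (hG.indicator hDm).comp (hsm γ)
  calc 2 * ∫⁻ w in S, G w = ∫⁻ w, 2 * S.indicator G w := by
        rw [lintegral_const_mul _ (hG.indicator hSm), lintegral_indicator hSm]
    _ ≤ ∫⁻ w, ∑' γ : SL(2, ℤ), S.indicator 1 w * Set.indicator 𝒟 G (γ • w) := lintegral_mono hcover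
    _ = ∑' γ : SL(2, ℤ), ∫⁻ w, S.indicator 1 w * Set.indicator 𝒟 G (γ • w) :=
        lintegral_tsum fun γ => ((measurable_one.indicator hSm).mul (hm2 γ)).aemeasurable
    _ = ∑' γ : SL(2, ℤ), ∫⁻ w, S.indicator 1 (γ⁻¹ • w) * Set.indicator 𝒟 G w := by
        refine tsum_congr fun γ => ?_
        refine Eq.trans (lintegral_congr fun w => ?_) ((measurePreserving_smul_SL γ).lintegral_comp
          ((hm1 γ⁻¹).mul (hG.indicator hDm)))
        simp only [inv_smul_smul]
    _ = ∫⁻ w, ∑' γ : SL(2, ℤ), S.indicator 1 (γ⁻¹ • w) * Set.indicator 𝒟 G w :=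
        (lintegral_tsum fun γ => ((hm1 γ⁻¹).mul (hG.indicator hDm)).aemeasurable).symm
    _ ≤ ∫⁻ w, T.card * Set.indicator 𝒟 G w := by
        refine lintegral_mono fun w => ?_
        rw [ENNReal.tsum_mul_right]
        gcongr
        exact hcard w
    _ = T.card * ∫⁻ w in 𝒟, G w := by
        rw [lintegral_const_mul _ (hG.indicator hDm), lintegral_indicator hDm]

/-- The pointwise upper bound for the Bergman kernel on the diagonal. -/
lemma sum_peterssonDensity_mul_le_card {k : ℕ} {B : Finset (CuspForm 𝒮ℒ (k : ℤ))}
    (hB : IsPeterssonOrthonormalBasis B) (hk : 2 ≤ k) (z : ℍ) {s : ℝ} (hs : 0 < s)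
    (hsk : k ≤ (1 + s ^ 2) ^ (k - 1)) (T : Finset SL(2, ℤ))
    (hT : ∀ γ : SL(2, ℤ), Real.sinh (dist z (γ • z) / 2) < 2 * s * √(1 + s ^ 2) → γ ∈ T) :
    (∑ f ∈ B, peterssonDensity k f z) * ENNReal.ofReal (8 * Real.pi / k) ≤ T.card := by
  let l : CuspForm 𝒮ℒ (k : ℤ) →ₗ[ℂ] ℂ := ⟨⟨fun f => f z, fun _ _ => rfl⟩, fun _ _ => rfl⟩
  have hT0 : (T.card : ℝ≥0∞) ≠ 0 := by
    have h1 : (1 : SL(2, ℤ)) ∈ T := hT 1 (by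
      have : 0 < √(1 + s ^ 2) := Real.sqrt_pos.2 (by positivity)
      simp only [one_smul, dist_self, zero_div, Real.sinh_zero]
      positivity)
    exact_mod_cast (Finset.card_pos.2 ⟨_, h1⟩).ne'
  have hTt : (T.card : ℝ≥0∞) ≠ ⊤ := ENNReal.natCast_ne_top _
  have h8 : ENNReal.ofReal (8 * Real.pi / k) = 2 * ENNReal.ofReal (4 * Real.pi / k) := by
    rw [← ENNReal.ofReal_ofNat 2, ← ENNReal.ofReal_mul (by norm_num)]
    congr 1
    ring
  -- The functional is evaluation at `z`; the sub-mean value inequality and the unfolding together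
  -- supply its norm bound.
  have h := sum_enorm_sq_mul_le_one hB l
    (ENNReal.ofReal (z.im ^ k) * ENNReal.ofReal (8 * Real.pi / k) / T.card) (fun g => by
      rw [← mul_div_assoc, ENNReal.div_le_iff hT0 hTt, mul_comm (lintegral _ _)]
      refine le_trans ?_ (two_mul_lintegral_le_card_mul
        (measurable_peterssonDensity k (continuous_cuspForm g)) (peterssonDensity_smul g) z s T hT)
      refine le_trans (le_of_eq ?_) (mul_le_mul_right
        (peterssonDensity_mul_le_lintegral_sinh hk (CuspFormClass.holo g) z hs hsk) 2)
      rw [h8, peterssonDensity_eq]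
      change ‖g z‖ₑ ^ 2 * _ = _
      ring)
  rw [← mul_div_assoc, ENNReal.div_le_iff hT0 hTt, one_mul, ← mul_assoc, Finset.sum_mul] at h
  simp only [peterssonDensity_eq]
  exact h

end unfolding

/-! ### Parseval for absolutely convergent Fourier series -/

section parseval

lemma Orthonormal.hasSum_norm_sq {ι E : Type*} [NormedAddCommGroup E] [InnerProductSpace ℂ E]
    {e : ι → E} (he : Orthonormal ℂ e) {c : ι → ℂ} {u : E} (hu : HasSum (fun i => c i • e i) u) :
    HasSum (fun i => ‖c i‖ ^ 2) (‖u‖ ^ 2) := by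
  classical
  have h1 (j : ι) : inner ℂ (e j) u = c j := by
    have h := hu.mapL (innerSL ℂ (e j))
    simp only [innerSL_apply_apply, inner_smul_right, orthonormal_iff_ite.1 he] at h
    have h' := hasSum_single (f := fun i => c i * (if j = i then 1 else 0)) j
      fun i hi => by simp [hi.symm]
    simpa using h.unique h'
  have h2 := hu.mapL (innerSL ℂ u)
  simp only [innerSL_apply_apply, inner_smul_right] at h2
  have h3 : HasSum (fun i => ((‖c i‖ ^ 2 : ℝ) : ℂ)) ((‖u‖ ^ 2 : ℝ) : ℂ) := by
    have e1 (i : ι) : ((‖c i‖ ^ 2 : ℝ) : ℂ) = c i * inner ℂ u (e i) := by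
      rw [← inner_conj_symm, h1, Complex.mul_conj']
      push_cast
      rfl
    have e2 : ((‖u‖ ^ 2 : ℝ) : ℂ) = inner ℂ u u := by
      rw [inner_self_eq_norm_sq_to_K]
      push_cast
      rfl
    rw [funext e1, e2]
    exact h2
  exact Complex.hasSum_ofReal.1 h3

/-- Absolute summability gives uniform convergence on the circle of length 1, hence convergence in
`L²`, where the characters are orthonormal. -/
lemma lintegral_enorm_sq_eq_tsum {c : ℕ → ℂ} (hc : Summable fun m => ‖c m‖) {g : ℝ → ℂ}
    (hg : ∀ x : ℝ, HasSum (fun m : ℕ => c m * Complex.exp (2 * Real.pi * Complex.I * m * x)) (g x)) :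
    ∫⁻ x in Set.Icc (-(1 / 2) : ℝ) (1 / 2), ‖g x‖ₑ ^ 2 = ∑' m, ‖c m‖ₑ ^ 2 := by
  have hs : Summable fun m : ℕ => c m • (fourier (m : ℤ) : C(AddCircle (1 : ℝ), ℂ)) := by
    refine Summable.of_norm ?_
    simpa only [norm_smul, fourier_norm, mul_one] using hc
  obtain ⟨F, hF⟩ := hs
  have hFg (x : ℝ) : F (x : AddCircle (1 : ℝ)) = g x := by
    refine (ContinuousMap.hasSum_apply hF (x : AddCircle (1 : ℝ))).unique ?_
    have e (m : ℕ) : (c m • (fourier (m : ℤ) : C(AddCircle (1 : ℝ), ℂ))) (x : AddCircle (1 : ℝ))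
        = c m * Complex.exp (2 * Real.pi * Complex.I * m * x) := by
      rw [ContinuousMap.smul_apply, fourier_coe_apply, smul_eq_mul, Int.cast_natCast,
        Complex.ofReal_one, div_one]
    rw [funext e]
    exact hg x
  have hL := hF.mapL (ContinuousMap.toLp 2 AddCircle.haarAddCircle ℂ)
  simp only [map_smul] at hL
  have hort : Orthonormal ℂ fun m : ℕ => fourierLp (T := 1) 2 (m : ℤ) :=
    orthonormal_fourier.comp _ Nat.cast_injective
  have hn := hort.hasSum_norm_sq hL
  have hvol : (volume : Measure (AddCircle (1 : ℝ))) = AddCircle.haarAddCircle := by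
    rw [AddCircle.volume_eq_smul_haarAddCircle]; simp
  have h1 : ∫⁻ x in Set.Icc (-(1 / 2) : ℝ) (1 / 2), ‖g x‖ₑ ^ 2
      = ∫⁻ t : AddCircle (1 : ℝ), ‖F t‖ₑ ^ 2 ∂AddCircle.haarAddCircle := by
    rw [← hvol, ← AddCircle.lintegral_preimage 1 (-(1 / 2)), setLIntegral_congr Ioc_ae_eq_Icc.symm]
    simp only [hFg]
    norm_num
  rw [h1]
  have h2 : ∫⁻ t : AddCircle (1 : ℝ), ‖F t‖ₑ ^ 2 ∂AddCircle.haarAddCircle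
      = ‖ContinuousMap.toLp 2 AddCircle.haarAddCircle ℂ F‖ₑ ^ 2 := by
    rw [Lp.enorm_def, eLpNorm_congr_ae (ContinuousMap.coeFn_toLp _ F),
      eLpNorm_eq_lintegral_rpow_enorm_toReal two_ne_zero ENNReal.ofNat_ne_top,
      ← ENNReal.rpow_natCast, ← ENNReal.rpow_mul]
    simp
  rw [h2, ← ofReal_norm, ← ENNReal.ofReal_pow (norm_nonneg _), ← hn.tsum_eq,
    ENNReal.ofReal_tsum_of_nonneg (fun _ => by positivity) hn.summable]
  refine tsum_congr fun m => ?_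
  rw [ENNReal.ofReal_pow (norm_nonneg _), ofReal_norm]

end parseval

/-! ### Mass in the cusp through Fourier coefficients -/

section cusp

variable {k : ℕ}

/-- The Fourier coefficient at infinity, as a linear functional on cusp forms. -/
def cuspCoeff (k m : ℕ) : CuspForm 𝒮ℒ (k : ℤ) →ₗ[ℂ] ℂ where
  toFun f := (qExpansion 1 f).coeff m
  map_add' f g := by
    rw [FunLike.coe_add, ModularForm.qExpansion_add one_pos (by simp) f g, map_add]
  map_smul' c f := by
    rw [FunLike.coe_smul, ModularForm.qExpansion_smul one_pos (by simp) c f,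
      PowerSeries.coeff_smul, smul_eq_mul, RingHom.id_apply, smul_eq_mul]

lemma cuspCoeff_zero (f : CuspForm 𝒮ℒ (k : ℤ)) : cuspCoeff k 0 f = 0 :=
  CuspFormClass.qExpansion_coeff_zero f one_pos (by simp)

lemma lintegral_horizontal (f : CuspForm 𝒮ℒ (k : ℤ)) {y : ℝ} (hy : 0 < y) :
    ∫⁻ x in Set.Icc (-(1 / 2) : ℝ) (1 / 2), ‖f (ofComplex ⟨x, y⟩)‖ₑ ^ 2
      = ∑' m, ‖cuspCoeff k m f‖ₑ ^ 2 * ENNReal.ofReal (Real.exp (-(4 * Real.pi * m * y))) := by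
  have hsum (x : ℝ) : HasSum (fun m : ℕ => cuspCoeff k m f * Real.exp (-(2 * Real.pi * m * y))
      * Complex.exp (2 * Real.pi * Complex.I * m * x)) (f (ofComplex ⟨x, y⟩)) := by
    have h := ModularForm.hasSum_qExpansion (h := 1) f one_pos (by simp) (⟨⟨x, y⟩, hy⟩ : ℍ)
    rw [ofComplex_apply_of_im_pos (z := ⟨x, y⟩) hy]
    convert h using 2 with m
    rw [mul_assoc]
    congr 1
    rw [Function.Periodic.qParam, ← Complex.exp_nat_mul, Complex.ofReal_exp, ← Complex.exp_add]
    congr 1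
    have : (((⟨⟨x, y⟩, hy⟩ : ℍ) : ℂ)) = x + y * Complex.I := Complex.mk_eq_add_mul_I x y
    rw [this]
    push_cast
    linear_combination (-(2 * Real.pi * m * y : ℂ)) * Complex.I_sq
  have hc : Summable fun m : ℕ => ‖cuspCoeff k m f * Real.exp (-(2 * Real.pi * m * y))‖ := by
    -- At `x = 0` the exponential factors equal 1, so convergence of the expansion there is already
    -- the required summability.
    simpa using (hsum 0).summable.norm
  rw [lintegral_enorm_sq_eq_tsum hc hsum]
  refine tsum_congr fun m => ?_
  rw [enorm_mul, mul_pow]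
  congr 1
  rw [← ofReal_norm, Complex.norm_real, Real.norm_of_nonneg (Real.exp_pos _).le,
    ← ENNReal.ofReal_pow (Real.exp_pos _).le, ← Real.exp_nat_mul]
  congr 2
  push_cast
  ring

/-- The incomplete Gamma integral `∫_Y^∞ exp (-4 π m y) y ^ k dy / y ^ 2`. -/
def cuspIntegral (k m : ℕ) (Y : ℝ) : ℝ≥0∞ :=
  ∫⁻ y in Set.Ioi Y, ENNReal.ofReal (Real.exp (-(4 * Real.pi * m * y)) * (y ^ k * (y ^ 2)⁻¹))

lemma measurable_ofComplex : Measurable (ofComplex : ℂ → ℍ) := by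
  rw [← measurableEmbedding_coe.measurable_comp_iff]
  have : UpperHalfPlane.coe ∘ ofComplex
      = fun w : ℂ => if 0 < w.im then w else (Classical.choice inferInstance : ℍ) := by
    ext w
    simp only [Function.comp_apply, ofComplex_apply_eq_ite]
    split_ifs <;> rfl
  rw [this]
  exact Measurable.ite (measurableSet_lt measurable_const Complex.measurable_im) measurable_id
    measurable_const

/-- The vertical half-strip above height `Y`. -/
def cuspStrip (Y : ℝ) : Set ℍ := {z | z.re ∈ Set.Icc (-(1 / 2) : ℝ) (1 / 2) ∧ Y < z.im}

lemma measurableSet_cuspStrip (Y : ℝ) : MeasurableSet (cuspStrip Y) :=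
  (UpperHalfPlane.continuous_re.measurable measurableSet_Icc).inter
    (UpperHalfPlane.continuous_im.measurable measurableSet_Ioi)

lemma lintegral_cuspStrip (f : CuspForm 𝒮ℒ (k : ℤ)) {Y : ℝ} (hY : 0 ≤ Y) :
    ∫⁻ z in cuspStrip Y, peterssonDensity k f z
      = ∑' m, ‖cuspCoeff k m f‖ₑ ^ 2 * cuspIntegral k m Y := by
  have hden : peterssonDensity k f = fun z : ℍ => peterssonDensity k f (ofComplex z) := by
    ext z; rw [ofComplex_apply]
  have hm0 := measurable_peterssonDensity k (continuous_cuspForm f)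
  have hm1 : Measurable fun w : ℂ => peterssonDensity k f (ofComplex w) :=
    hm0.comp measurable_ofComplex
  have himg : UpperHalfPlane.coe '' cuspStrip Y
      = {w : ℂ | w.re ∈ Set.Icc (-(1 / 2) : ℝ) (1 / 2) ∧ Y < w.im} := by
    ext w
    constructor
    · rintro ⟨z, hz, rfl⟩
      exact hz
    · exact fun hw => ⟨⟨w, hY.trans_lt hw.2⟩, hw, rfl⟩
  have hset : MeasurableSet (UpperHalfPlane.coe '' cuspStrip Y) :=
    measurableEmbedding_coe.measurableSet_image.2 (measurableSet_cuspStrip Y)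
  set H : ℂ → ℝ≥0∞ := (UpperHalfPlane.coe '' cuspStrip Y).indicator fun w =>
    peterssonDensity k f (ofComplex w) * ENNReal.ofReal ((w.im ^ 2)⁻¹) with hH
  have hHm : Measurable H := by
    refine Measurable.indicator (hm1.mul ?_) hset
    have := Complex.measurable_im
    fun_prop
  have hHval (x y : ℝ) : H ⟨x, y⟩ = (Set.Ioi Y).indicator (fun y =>
      (Set.Icc (-(1 / 2) : ℝ) (1 / 2)).indicator (fun x =>
        ‖f (ofComplex ⟨x, y⟩)‖ₑ ^ 2 * ENNReal.ofReal (y ^ k * (y ^ 2)⁻¹)) x) y := by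
    rw [hH, himg]
    by_cases hy : y ∈ Set.Ioi Y
    · have hy0 : 0 < y := hY.trans_lt hy
      rw [Set.indicator_of_mem hy]
      by_cases hx : x ∈ Set.Icc (-(1 / 2) : ℝ) (1 / 2)
      · rw [Set.indicator_of_mem hx, Set.indicator_of_mem (by exact ⟨hx, hy⟩), peterssonDensity_eq,
          ENNReal.ofReal_mul (by positivity), mul_assoc]
        congr 3
        rw [ofComplex_apply_of_im_pos (z := ⟨x, y⟩) hy0]
        rfl
      · rw [Set.indicator_of_notMem hx, Set.indicator_of_notMem (fun h => hx h.1)]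
    · rw [Set.indicator_of_notMem hy, Set.indicator_of_notMem (fun h => hy h.2)]
  have hmk : Measurable fun p : ℝ × ℝ => H ⟨p.1, p.2⟩ :=
    hHm.comp Complex.measurableEquivRealProd.symm.measurable
  calc ∫⁻ z in cuspStrip Y, peterssonDensity k f z = ∫⁻ w, H w := by
        rw [hden]
        refine (setLIntegral_upperHalfPlane _ (fun w => peterssonDensity k f (ofComplex w))
          (hden ▸ hm0)).trans ?_
        rw [hH, lintegral_indicator hset]
    _ = ∫⁻ y : ℝ, ∫⁻ x : ℝ, H ⟨x, y⟩ := by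
        rw [lintegral_complex_eq H hHm]
        exact lintegral_lintegral_swap hmk.aemeasurable
    _ = ∫⁻ y in Set.Ioi Y, ∫⁻ x in Set.Icc (-(1 / 2) : ℝ) (1 / 2),
          ‖f (ofComplex ⟨x, y⟩)‖ₑ ^ 2 * ENNReal.ofReal (y ^ k * (y ^ 2)⁻¹) := by
        rw [← lintegral_indicator measurableSet_Ioi]
        refine lintegral_congr fun y => ?_
        simp_rw [hHval]
        by_cases hy : y ∈ Set.Ioi Y
        · simp only [Set.indicator_of_mem hy]
          rw [lintegral_indicator measurableSet_Icc]
        · simp only [Set.indicator_of_notMem hy, lintegral_zero]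
    _ = ∫⁻ y in Set.Ioi Y, ∑' m, ‖cuspCoeff k m f‖ₑ ^ 2 *
          ENNReal.ofReal (Real.exp (-(4 * Real.pi * m * y)) * (y ^ k * (y ^ 2)⁻¹)) := by
        refine setLIntegral_congr_fun measurableSet_Ioi fun y hy => ?_
        have hy0 : 0 < y := hY.trans_lt hy
        rw [lintegral_mul_const' _ _ ENNReal.ofReal_ne_top, lintegral_horizontal f hy0,
          ← ENNReal.tsum_mul_right]
        refine tsum_congr fun m => ?_
        rw [mul_assoc, ← ENNReal.ofReal_mul (Real.exp_pos _).le]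
    _ = _ := by
        rw [lintegral_tsum fun m => by fun_prop]
        refine tsum_congr fun m => ?_
        rw [cuspIntegral, lintegral_const_mul _ (by fun_prop)]

lemma cuspStrip_one_subset : cuspStrip 1 ⊆ 𝒟 := by
  intro z hz
  refine ⟨?_, abs_le.2 hz.1⟩
  rw [Complex.normSq_apply, UpperHalfPlane.coe_re, UpperHalfPlane.coe_im]
  nlinarith [hz.2, mul_self_nonneg z.re]

variable {B : Finset (CuspForm 𝒮ℒ (k : ℤ))}

/-- The strip above height 1 lies in `𝒟`, and a single term of Parseval there bounds the coefficient
functional by the Petersson norm. -/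
lemma sum_cuspCoeff_mul_le_one (hB : IsPeterssonOrthonormalBasis B) (m : ℕ) :
    (∑ f ∈ B, ‖cuspCoeff k m f‖ₑ ^ 2) * cuspIntegral k m 1 ≤ 1 := by
  refine sum_enorm_sq_mul_le_one hB _ _ fun g => ?_
  refine le_trans ?_ (lintegral_mono_set cuspStrip_one_subset)
  rw [lintegral_cuspStrip g zero_le_one]
  exact ENNReal.le_tsum (f := fun m => ‖cuspCoeff k m g‖ₑ ^ 2 * cuspIntegral k m 1) m

/-- Substitute `y = u + Y / 2`. Since `u ≥ Y / 2`, the power grows by at most `2 ^ n`, while the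
exponential gains `exp (-2πmY)`, which wins once `mY` exceeds the weight. -/
lemma cuspIntegral_le (n m : ℕ) {Y : ℝ} (hY : 2 ≤ Y) :
    cuspIntegral (n + 2) m Y
      ≤ ENNReal.ofReal (2 ^ n * Real.exp (-(2 * Real.pi * m * Y))) * cuspIntegral (n + 2) m 1 := by
  have hshift : cuspIntegral (n + 2) m Y = ∫⁻ u in Set.Ioi (Y / 2), ENNReal.ofReal
      (Real.exp (-(4 * Real.pi * m * (u + Y / 2))) *
        ((u + Y / 2) ^ (n + 2) * ((u + Y / 2) ^ 2)⁻¹)) := by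
    rw [cuspIntegral, ← lintegral_indicator measurableSet_Ioi,
      ← lintegral_indicator measurableSet_Ioi, ← lintegral_add_right_eq_self _ (Y / 2)]
    refine lintegral_congr fun u => ?_
    by_cases hu : u ∈ Set.Ioi (Y / 2)
    · have : u + Y / 2 ∈ Set.Ioi Y := by
        simp only [Set.mem_Ioi] at hu ⊢
        linarith
      rw [Set.indicator_of_mem hu, Set.indicator_of_mem this]
    · have : u + Y / 2 ∉ Set.Ioi Y := by
        simp only [Set.mem_Ioi, not_lt] at hu ⊢
        linarith
      rw [Set.indicator_of_notMem hu, Set.indicator_of_notMem this]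
  rw [hshift, cuspIntegral, ← lintegral_const_mul _ (by fun_prop)]
  refine le_trans ?_ (lintegral_mono_set (Set.Ioi_subset_Ioi (show (1 : ℝ) ≤ Y / 2 by linarith)))
  refine setLIntegral_mono' measurableSet_Ioi fun u hu => ?_
  rw [Set.mem_Ioi] at hu
  have hu0 : 0 < u := by linarith
  rw [← ENNReal.ofReal_mul (by positivity)]
  refine ENNReal.ofReal_le_ofReal ?_
  have e1 : (u + Y / 2) ^ (n + 2) * ((u + Y / 2) ^ 2)⁻¹ = (u + Y / 2) ^ n := by
    rw [pow_add, mul_assoc, mul_inv_cancel₀ (by positivity), mul_one]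
  have e2 : u ^ (n + 2) * (u ^ 2)⁻¹ = u ^ n := by
    rw [pow_add, mul_assoc, mul_inv_cancel₀ (by positivity), mul_one]
  have e3 : Real.exp (-(4 * Real.pi * m * (u + Y / 2)))
      = Real.exp (-(2 * Real.pi * m * Y)) * Real.exp (-(4 * Real.pi * m * u)) := by
    rw [← Real.exp_add]
    congr 1
    ring
  have e4 : (u + Y / 2) ^ n ≤ 2 ^ n * u ^ n := by
    rw [← mul_pow]
    exact pow_le_pow_left₀ (by positivity) (by linarith) n
  rw [e1, e2, e3]
  calc _ ≤ Real.exp (-(2 * Real.pi * m * Y)) * Real.exp (-(4 * Real.pi * m * u)) *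
        (2 ^ n * u ^ n) := by gcongr
    _ = _ := by ring

/-- The total mass of the Bergman kernel in the cusp above height `Y` is `O(k / Y)`. -/
lemma sum_lintegral_cuspStrip_le (hB : IsPeterssonOrthonormalBasis B) (hk : 2 ≤ k) {Y : ℝ}
    (hY : 2 ≤ Y) :
    ∑ f ∈ B, ∫⁻ z in cuspStrip Y, peterssonDensity k f z ≤ ENNReal.ofReal (k / Y + 2) := by
  have hY0 : 0 < Y := by linarith
  set S : ℕ → ℝ≥0∞ := fun m => ∑ f ∈ B, ‖cuspCoeff k m f‖ₑ ^ 2 with hS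
  -- The term `m = 0` has no exponential decay and must be removed by cuspidality.
  have hS0 : S 0 = 0 := by simp [hS, cuspCoeff_zero]
  have hmono (m : ℕ) : cuspIntegral k m Y ≤ cuspIntegral k m 1 :=
    lintegral_mono_set (Set.Ioi_subset_Ioi (by linarith))
  -- Each of the at most `k / Y` indices in `J` contributes at most 1; the remaining ones are
  -- dominated by a geometric series of sum 2.
  set J := Finset.Icc 1 ⌊k / Y⌋₊ with hJ
  have hterm (m : ℕ) : S m * cuspIntegral k m Y ≤ (if m ∈ J then 1 else 0) + (2⁻¹ : ℝ≥0∞) ^ m := by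
    by_cases hm : m ∈ J
    · rw [if_pos hm]
      refine le_trans ?_ le_self_add
      exact (mul_le_mul_right (hmono m) _).trans (sum_cuspCoeff_mul_le_one hB m)
    · rw [if_neg hm, zero_add]
      rcases Nat.eq_zero_or_pos m with rfl | hm0
      · simp [hS0]
      have hmk : k / Y < m := by
        rw [hJ, Finset.mem_Icc, not_and, not_le] at hm
        exact (Nat.floor_lt (by positivity)).1 (hm hm0)
      rw [div_lt_iff₀ hY0] at hmk
      obtain ⟨n, rfl⟩ : ∃ n, k = n + 2 := ⟨k - 2, by omega⟩
      calc S m * cuspIntegral (n + 2) m Y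
          ≤ S m * (ENNReal.ofReal (2 ^ n * Real.exp (-(2 * Real.pi * m * Y)))
              * cuspIntegral (n + 2) m 1) := by
            gcongr
            exact cuspIntegral_le n m hY
        _ = ENNReal.ofReal (2 ^ n * Real.exp (-(2 * Real.pi * m * Y))) *
              (S m * cuspIntegral (n + 2) m 1) := by ring
        _ ≤ ENNReal.ofReal (2 ^ n * Real.exp (-(2 * Real.pi * m * Y))) * 1 := by
            gcongr
            exact sum_cuspCoeff_mul_le_one hB m
        _ ≤ ENNReal.ofReal ((2⁻¹) ^ m) := by
            rw [mul_one]
            refine ENNReal.ofReal_le_ofReal ?_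
            have h2 : (2 : ℝ) ≤ Real.exp 1 := by linarith [Real.add_one_le_exp (1 : ℝ)]
            have h3 : (2 : ℝ) ^ n ≤ Real.exp n := by
              rw [← mul_one (n : ℝ), Real.exp_nat_mul]
              gcongr
            have h4 : Real.exp (-(m : ℝ)) ≤ (2⁻¹) ^ m := by
              rw [Real.exp_neg, inv_pow, ← mul_one (m : ℝ), Real.exp_nat_mul]
              gcongr
            refine le_trans ?_ h4
            calc (2 : ℝ) ^ n * Real.exp (-(2 * Real.pi * m * Y))
                ≤ Real.exp n * Real.exp (-(2 * Real.pi * m * Y)) := by gcongr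
              _ = Real.exp (n + -(2 * Real.pi * m * Y)) := (Real.exp_add _ _).symm
              _ ≤ Real.exp (-(m : ℝ)) := by
                refine Real.exp_le_exp.2 ?_
                push_cast at hmk
                have hmR : (0 : ℝ) < m := by exact_mod_cast hm0
                -- As `n < mY`, the exponent `n - 2πmY` is below `-5mY`, more than enough for `-m`.
                have h5 : 3 * (m * Y) ≤ Real.pi * (m * Y) := by
                  gcongr
                  exact Real.pi_gt_three.le
                have h6 : m * 2 ≤ m * Y := by gcongr
                linarith
        _ = (2⁻¹ : ℝ≥0∞) ^ m := by
            rw [ENNReal.ofReal_pow (by norm_num), ENNReal.ofReal_inv_of_pos two_pos,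
              ENNReal.ofReal_ofNat]
  calc ∑ f ∈ B, ∫⁻ z in cuspStrip Y, peterssonDensity k f z
      = ∑' m, S m * cuspIntegral k m Y := by
        simp_rw [lintegral_cuspStrip _ hY0.le, hS, Finset.sum_mul]
        exact (Summable.tsum_finsetSum fun _ _ => ENNReal.summable).symm
    _ ≤ ∑' m, ((if m ∈ J then 1 else 0) + (2⁻¹ : ℝ≥0∞) ^ m) := ENNReal.tsum_le_tsum hterm
    _ = J.card + 2 := by
        rw [ENNReal.tsum_add, ENNReal.tsum_geometric, tsum_eq_sum (s := J) (fun m hm => if_neg hm),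
          Finset.sum_congr rfl (fun m hm => if_pos hm), ENNReal.one_sub_inv_two, inv_inv]
        simp
    _ ≤ ENNReal.ofReal (k / Y + 2) := by
        rw [ENNReal.ofReal_add (by positivity) (by norm_num), ENNReal.ofReal_ofNat, hJ,
          Nat.card_Icc, Nat.add_sub_cancel]
        gcongr
        rw [← ENNReal.ofReal_natCast]
        exact ENNReal.ofReal_le_ofReal (Nat.floor_le (by positivity))

end cusp

/-! ### Areas of the fundamental domain and of the neighbourhood of the arc -/

section volume_fd

lemma volume_eq_lintegral_lintegral {S : Set ℍ} (hS : MeasurableSet S) :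
    volume S = ∫⁻ x : ℝ, ∫⁻ y : ℝ, (UpperHalfPlane.coe '' S).indicator
      (fun w => ENNReal.ofReal ((w.im ^ 2)⁻¹)) ⟨x, y⟩ := by
  have hset := measurableEmbedding_coe.measurableSet_image.2 hS
  have h := setLIntegral_upperHalfPlane S (fun _ => 1) measurable_const
  simp only [one_mul, setLIntegral_one] at h
  rw [h, ← lintegral_indicator hset]
  refine lintegral_complex_eq _ (Measurable.indicator ?_ hset)
  have := Complex.measurable_im
  fun_prop

lemma lintegral_Ici_inv_sq {a : ℝ} (ha : 0 < a) :
    ∫⁻ y in Set.Ici a, ENNReal.ofReal ((y ^ 2)⁻¹) = ENNReal.ofReal a⁻¹ := by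
  rw [setLIntegral_congr Ioi_ae_eq_Ici.symm]
  have h1 : ∫⁻ y in Set.Ioi a, ENNReal.ofReal ((y ^ 2)⁻¹)
      = ∫⁻ y in Set.Ioi a, ENNReal.ofReal (y ^ (-2 : ℝ)) := by
    refine setLIntegral_congr_fun measurableSet_Ioi fun y hy => ?_
    have hy0 : 0 < y := ha.trans hy
    simp only [Real.rpow_neg hy0.le, Real.rpow_ofNat]
  rw [h1, ← ofReal_integral_eq_lintegral_ofReal
    (integrableOn_Ioi_rpow_of_lt (by norm_num) ha), integral_Ioi_rpow_of_lt (by norm_num) ha]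
  · norm_num [Real.rpow_neg_one]
  · refine (ae_restrict_iff' measurableSet_Ioi).2 (Filter.Eventually.of_forall fun y hy => ?_)
    exact Real.rpow_nonneg (ha.trans hy).le _

lemma lintegral_inv_sqrt_one_sub_sq :
    ∫⁻ x in Set.Icc (-(1 / 2) : ℝ) (1 / 2), ENNReal.ofReal (√(1 - x ^ 2))⁻¹
      = ENNReal.ofReal (Real.pi / 3) := by
  have hpos : ∀ x ∈ Set.Icc (-(1 / 2) : ℝ) (1 / 2), 0 < 1 - x ^ 2 := by
    intro x hx
    nlinarith [hx.1, hx.2]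
  have hc : ContinuousOn (fun x : ℝ => (√(1 - x ^ 2))⁻¹) (Set.Icc (-(1 / 2) : ℝ) (1 / 2)) :=
    ContinuousOn.inv₀ (by fun_prop) fun x hx => (Real.sqrt_pos.2 (hpos x hx)).ne'
  rw [← ofReal_integral_eq_lintegral_ofReal hc.integrableOn_Icc
    (Filter.Eventually.of_forall fun x => by positivity), integral_Icc_eq_integral_Ioc,
    ← intervalIntegral.integral_of_le (by norm_num),
    intervalIntegral.integral_eq_sub_of_hasDerivAt (f := Real.arcsin)]
  · have h : Real.arcsin (1 / 2) = Real.pi / 6 := by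
      rw [← Real.sin_pi_div_six]
      exact Real.arcsin_sin (by linarith [Real.pi_pos]) (by linarith [Real.pi_pos])
    rw [Real.arcsin_neg, h]
    congr 1
    ring
  · intro x hx
    rw [Set.uIcc_of_le (by norm_num)] at hx
    have := Real.hasDerivAt_arcsin (x := x) (by linarith [hx.1]) (by linarith [hx.2])
    simpa using this
  · refine ContinuousOn.intervalIntegrable ?_
    rwa [Set.uIcc_of_le (by norm_num)]

lemma volume_fd : volume (𝒟 : Set ℍ) = ENNReal.ofReal (Real.pi / 3) := by
  rw [volume_eq_lintegral_lintegral ModularGroup.isClosed_fd.measurableSet,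
    ← lintegral_inv_sqrt_one_sub_sq, ← lintegral_indicator measurableSet_Icc]
  refine lintegral_congr fun x => ?_
  rw [ModularGroup.coe_fd]
  by_cases hx : x ∈ Set.Icc (-(1 / 2) : ℝ) (1 / 2)
  · have hx2 : 0 < 1 - x ^ 2 := by nlinarith [hx.1, hx.2]
    have hs : 0 < √(1 - x ^ 2) := Real.sqrt_pos.2 hx2
    rw [Set.indicator_of_mem hx, ← lintegral_Ici_inv_sq hs, ← lintegral_indicator measurableSet_Ici]
    refine lintegral_congr fun y => ?_
    have hiff : (⟨x, y⟩ : ℂ) ∈ {z : ℂ | 0 < z.im ∧ 1 ≤ ‖z‖ ∧ |z.re| ≤ 1 / 2}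
        ↔ y ∈ Set.Ici √(1 - x ^ 2) := by
      have e : (1 ≤ ‖(⟨x, y⟩ : ℂ)‖) ↔ 1 ≤ x ^ 2 + y ^ 2 := by
        rw [← one_le_sq_iff₀ (norm_nonneg _), ← Complex.normSq_eq_norm_sq, Complex.normSq_mk]
        ring_nf
      simp only [Set.mem_ofPred_eq, e, Set.mem_Ici]
      constructor
      · rintro ⟨h1, h2, -⟩
        exact Real.sqrt_le_iff.2 ⟨h1.le, by linarith⟩
      · intro h
        have := (Real.sqrt_le_iff.1 h).2
        exact ⟨hs.trans_le h, by linarith, abs_le.2 hx⟩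
    by_cases hy : y ∈ Set.Ici √(1 - x ^ 2)
    · rw [Set.indicator_of_mem hy, Set.indicator_of_mem (hiff.2 hy)]
    · rw [Set.indicator_of_notMem hy, Set.indicator_of_notMem (fun h => hy (hiff.1 h))]
  · rw [Set.indicator_of_notMem hx]
    refine (lintegral_congr fun y => ?_).trans lintegral_zero
    exact Set.indicator_of_notMem (fun h => hx (abs_le.1 h.2.2)) _

/-- The part of the fundamental domain close to the unit circle. -/
def nearArc (ε : ℝ) : Set ℍ := {z | z ∈ 𝒟 ∧ Complex.normSq z ≤ 1 + ε}

lemma measurableSet_nearArc (ε : ℝ) : MeasurableSet (nearArc ε) :=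
  ModularGroup.isClosed_fd.measurableSet.inter
    (isClosed_le (Complex.continuous_normSq.comp continuous_coe) continuous_const).measurableSet

lemma volume_nearArc_le {ε : ℝ} (hε : 0 ≤ ε) :
    volume (nearArc ε) ≤ ENNReal.ofReal (4 / 3 * ε) := by
  rw [volume_eq_lintegral_lintegral (measurableSet_nearArc ε)]
  have hmain : ∀ x, ∫⁻ y : ℝ, (UpperHalfPlane.coe '' nearArc ε).indicator
      (fun w => ENNReal.ofReal ((w.im ^ 2)⁻¹)) ⟨x, y⟩
      ≤ (Set.Icc (-(1 / 2) : ℝ) (1 / 2)).indicator (fun _ => ENNReal.ofReal (4 / 3 * ε)) x := by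
    intro x
    by_cases hx : x ∈ Set.Icc (-(1 / 2) : ℝ) (1 / 2)
    · have hx2 : 3 / 4 ≤ 1 - x ^ 2 := by nlinarith [hx.1, hx.2]
      rw [Set.indicator_of_mem hx]
      have h1 : ∀ y, (UpperHalfPlane.coe '' nearArc ε).indicator
          (fun w => ENNReal.ofReal ((w.im ^ 2)⁻¹)) ⟨x, y⟩
          ≤ (Set.Icc √(1 - x ^ 2) (√(1 - x ^ 2) + ε)).indicator
              (fun _ => ENNReal.ofReal (4 / 3)) y := by
        intro y
        by_cases hm : (⟨x, y⟩ : ℂ) ∈ UpperHalfPlane.coe '' nearArc ε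
        · rw [Set.indicator_of_mem hm]
          obtain ⟨z, ⟨hz, hz2⟩, hzw⟩ := hm
          have hz1 := hz.1
          rw [hzw, Complex.normSq_mk] at hz1 hz2
          have hy : 0 < y := by
            have := z.im_pos
            rw [← UpperHalfPlane.coe_im, hzw] at this
            exact this
          have ha : √(1 - x ^ 2) ^ 2 = 1 - x ^ 2 := Real.sq_sqrt (by linarith)
          have ha0 := Real.sqrt_nonneg (1 - x ^ 2)
          -- This makes `(a + ε)² ≥ a² + ε` for `a = √(1 - x²)`, so each vertical fibre has length
          -- at most `ε`.
          have ha1 : 1 / 2 ≤ √(1 - x ^ 2) := Real.le_sqrt_of_sq_le (by linarith)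
          rw [Set.indicator_of_mem]
          · refine ENNReal.ofReal_le_ofReal ?_
            rw [inv_le_comm₀ (by positivity) (by norm_num)]
            change (4 / 3 : ℝ)⁻¹ ≤ y ^ 2
            nlinarith
          · constructor
            · exact Real.sqrt_le_iff.2 ⟨hy.le, by nlinarith⟩
            · exact (sq_le_sq₀ hy.le (by positivity)).1 (by nlinarith)
        · rw [Set.indicator_of_notMem hm]
          exact zero_le
      refine (lintegral_mono h1).trans ?_
      rw [lintegral_indicator measurableSet_Icc, setLIntegral_const, Real.volume_Icc,
        ← ENNReal.ofReal_mul (by norm_num)]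
      refine ENNReal.ofReal_le_ofReal (le_of_eq ?_)
      ring
    · rw [Set.indicator_of_notMem hx, nonpos_iff_eq_zero]
      refine (lintegral_congr fun y => ?_).trans lintegral_zero
      refine Set.indicator_of_notMem ?_ _
      rintro ⟨z, ⟨hz, -⟩, hzw⟩
      have := hz.2
      rw [← UpperHalfPlane.coe_re, hzw] at this
      exact hx (abs_le.1 this)
  refine (lintegral_mono hmain).trans ?_
  rw [lintegral_indicator measurableSet_Icc, setLIntegral_const, Real.volume_Icc]
  norm_num

end volume_fd

/-! ### The `L¹` estimate and the choice of radius -/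

section assembly

variable {k : ℕ} {B : Finset (CuspForm 𝒮ℒ (k : ℤ))}

lemma averagedMass_nonneg (B : Finset (CuspForm 𝒮ℒ (k : ℤ))) (z : ℍ) : 0 ≤ averagedMass B z := by
  have := z.im_pos
  unfold averagedMass
  positivity

lemma continuous_averagedMass (B : Finset (CuspForm 𝒮ℒ (k : ℤ))) : Continuous (averagedMass B) := by
  unfold averagedMass
  refine continuous_const.mul (continuous_finsetSum _ fun f _ => ?_)
  exact (UpperHalfPlane.continuous_im.pow k).mul ((continuous_cuspForm f).norm.pow 2)

lemma ofReal_averagedMass (B : Finset (CuspForm 𝒮ℒ (k : ℤ))) (z : ℍ) :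
    ENNReal.ofReal (averagedMass B z)
      = ENNReal.ofReal (B.card : ℝ)⁻¹ * ∑ f ∈ B, peterssonDensity k f z := by
  have := z.im_pos
  rw [averagedMass, ENNReal.ofReal_mul (by positivity),
    ENNReal.ofReal_sum_of_nonneg fun _ _ => by positivity]
  rfl

lemma setLIntegral_averagedMass (B : Finset (CuspForm 𝒮ℒ (k : ℤ))) (S : Set ℍ) :
    ∫⁻ z in S, ENNReal.ofReal (averagedMass B z)
      = ENNReal.ofReal (B.card : ℝ)⁻¹ * ∑ f ∈ B, ∫⁻ z in S, peterssonDensity k f z := by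
  simp_rw [ofReal_averagedMass]
  have hm (f : CuspForm 𝒮ℒ (k : ℤ)) := measurable_peterssonDensity k (continuous_cuspForm f)
  rw [lintegral_const_mul _ (Finset.measurable_sum _ fun f _ => hm f),
    lintegral_finsetSum _ fun f _ => hm f]

lemma lintegral_averagedMass_fd (hB : IsPeterssonOrthonormalBasis B) (h0 : 0 < B.card) :
    ∫⁻ z in 𝒟, ENNReal.ofReal (averagedMass B z) = 1 := by
  rw [setLIntegral_averagedMass,
    Finset.sum_congr rfl fun f hf => lintegral_peterssonDensity_of_mem hB hf]
  have : (0 : ℝ) < B.card := by exact_mod_cast h0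
  simp only [Finset.sum_const, nsmul_eq_mul, mul_one]
  rw [← ENNReal.ofReal_natCast, ← ENNReal.ofReal_mul (by positivity),
    inv_mul_cancel₀ this.ne', ENNReal.ofReal_one]

lemma averagedMass_le (hB : IsPeterssonOrthonormalBasis B) (hk : 2 ≤ k) (z : ℍ) {s : ℝ}
    (hs : 0 < s) (hsk : k ≤ (1 + s ^ 2) ^ (k - 1)) (T : Finset SL(2, ℤ))
    (hT : ∀ γ : SL(2, ℤ), Real.sinh (dist z (γ • z) / 2) < 2 * s * √(1 + s ^ 2) → γ ∈ T) :
    averagedMass B z ≤ k / B.card * (T.card / (8 * Real.pi)) := by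
  have h := sum_peterssonDensity_mul_le_card hB hk z hs hsk T hT
  have hz := z.im_pos
  have hk0 : (0 : ℝ) < k := by exact_mod_cast (by omega : 0 < k)
  simp only [peterssonDensity] at h
  rw [← ENNReal.ofReal_sum_of_nonneg fun _ _ => by positivity,
    ← ENNReal.ofReal_mul (Finset.sum_nonneg fun _ _ => by positivity), ← ENNReal.ofReal_natCast,
    ENNReal.ofReal_le_ofReal_iff (by positivity), ← le_div_iff₀ (by positivity)] at h
  rw [averagedMass]
  calc _ ≤ (B.card : ℝ)⁻¹ * (T.card / (8 * Real.pi / k)) := by gcongr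
    _ = _ := by field_simp

/-- The positive part of `averagedMass B - 3 / π` has small integral. -/
lemma lintegral_averagedMass_sub_le {T : Finset SL(2, ℤ)}
    (hT : ∀ γ : SL(2, ℤ), (∀ i j, |γ i j| ≤ 1) → γ ∈ T)
    (hB : IsPeterssonOrthonormalBasis B) (hk : 48 ≤ k) (hk2 : Even k) {s : ℝ} (hs : 0 < s)
    (hsk : k ≤ (1 + s ^ 2) ^ (k - 1)) {τ : ℝ} (hτs : 2 * s * √(1 + s ^ 2) ≤ τ)
    (hτ : τ ≤ 1 / 100) :
    ∫⁻ z in 𝒟, ENNReal.ofReal (averagedMass B z - 3 / Real.pi)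
      ≤ ENNReal.ofReal (150 / k + (7 * T.card + 48) * τ) := by
  have hkR : (48 : ℝ) ≤ k := by exact_mod_cast hk
  have hτ0 : 0 < τ := by
    refine lt_of_lt_of_le ?_ hτs
    have : 0 < √(1 + s ^ 2) := Real.sqrt_pos.2 (by positivity)
    positivity
  have hcard := card_ge hB (by omega) hk2
  have hd0 : (0 : ℝ) < B.card := by linarith
  have hpi := Real.pi_gt_three
  have hratio : (k : ℝ) / B.card ≤ 12 * (1 + 48 / k) := by
    rw [div_le_iff₀ hd0]
    have h1 : (12 * (1 + 48 / (k : ℝ))) * (k / 12 - 2) ≤ 12 * (1 + 48 / k) * B.card := by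
      gcongr
    refine le_trans ?_ h1
    have h2 : (12 * (1 + 48 / (k : ℝ))) * (k / 12 - 2) = k + 24 - 1152 / k := by
      field_simp
      ring
    have h3 : 1152 / (k : ℝ) ≤ 24 := by
      rw [div_le_iff₀ (by linarith)]
      linarith
    rw [h2]
    linarith
  have hratio' : (k : ℝ) / B.card ≤ 24 := by
    have : 48 / (k : ℝ) ≤ 1 := by
      rw [div_le_one (by linarith)]
      exact hkR
    linarith
  -- Below this height `small_displacement` applies, and above it the cuspidal mass is of order `k /
  -- Y = 2τk`, so both errors are `O(τ)` after averaging.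
  set Y := 1 / (2 * τ) with hY
  have hYτ : 2 * τ * Y = 1 := by rw [hY]; field_simp
  have hY2 : 2 ≤ Y := by
    rw [hY, le_div_iff₀ (by positivity)]
    linarith
  have hpt : ∀ z ∈ (𝒟 : Set ℍ), ENNReal.ofReal (averagedMass B z - 3 / Real.pi)
      ≤ ENNReal.ofReal (48 / k) + (nearArc (5 * τ)).indicator (fun _ => ENNReal.ofReal T.card) z
        + (cuspStrip Y).indicator (fun z => ENNReal.ofReal (averagedMass B z)) z := by
    intro z hz
    by_cases hzY : Y < z.im
    · refine le_trans ?_ le_add_self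
      rw [Set.indicator_of_mem (show z ∈ cuspStrip Y from ⟨abs_le.1 hz.2, hzY⟩)]
      refine ENNReal.ofReal_le_ofReal ?_
      have : 0 ≤ 3 / Real.pi := by positivity
      linarith
    · refine le_trans ?_ le_self_add
      have hzτ : 2 * τ * z.im ≤ 1 := by
        rw [← hYτ]
        exact mul_le_mul_of_nonneg_left (not_lt.1 hzY) (by positivity)
      by_cases hn : Complex.normSq z ≤ 1 + 5 * τ
      · refine le_trans ?_ le_add_self
        rw [Set.indicator_of_mem (show z ∈ nearArc (5 * τ) from ⟨hz, hn⟩)]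
        refine ENNReal.ofReal_le_ofReal ?_
        have h := averagedMass_le hB (by omega) z hs hsk T (fun γ hγ => by
          rcases small_displacement γ hz hτ hzτ (hγ.trans_le hτs) with (rfl | rfl) | h
          · refine hT _ fun i j => ?_
            fin_cases i <;> fin_cases j <;> simp
          · refine hT _ fun i j => ?_
            fin_cases i <;> fin_cases j <;> simp
          · exact hT _ h.1)
        have h2 : (T.card : ℝ) / (8 * Real.pi) ≤ T.card / 24 := by gcongr; linarith
        have h3 : 0 ≤ 3 / Real.pi := by positivity
        calc averagedMass B z - 3 / Real.pi ≤ averagedMass B z := by linarith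
          _ ≤ _ := h
          _ ≤ 24 * (T.card / 24) := by gcongr
          _ = T.card := by ring
      · refine le_trans ?_ le_self_add
        refine ENNReal.ofReal_le_ofReal ?_
        -- Here only `±1` occur, and `12 · 2 / (8π)` is exactly the main term `3 / π`.
        have h := averagedMass_le hB (by omega) z hs hsk {1, -1} (fun γ hγ => by
          rcases small_displacement γ hz hτ hzτ (hγ.trans_le hτs) with h | h
          · simpa using h
          · exact absurd h.2 hn)
        have h2 : ((({1, -1} : Finset SL(2, ℤ)).card : ℕ) : ℝ) ≤ 2 := by
          exact_mod_cast Finset.card_le_two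
        calc averagedMass B z - 3 / Real.pi
            ≤ 12 * (1 + 48 / k) * (2 / (8 * Real.pi)) - 3 / Real.pi := by
              refine sub_le_sub_right (h.trans ?_) _
              gcongr
          _ = 48 / k * (3 / Real.pi) := by
              field_simp
              ring
          _ ≤ 48 / k * 1 := by
              gcongr
              rw [div_le_one Real.pi_pos]
              exact hpi.le
          _ = _ := mul_one _
  calc _ ≤ ∫⁻ z in 𝒟, (ENNReal.ofReal (48 / k)
        + (nearArc (5 * τ)).indicator (fun _ => ENNReal.ofReal T.card) z
        + (cuspStrip Y).indicator (fun z => ENNReal.ofReal (averagedMass B z)) z) :=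
        setLIntegral_mono' ModularGroup.isClosed_fd.measurableSet hpt
    _ = ENNReal.ofReal (48 / k) * volume 𝒟
        + (∫⁻ z in 𝒟, (nearArc (5 * τ)).indicator (fun _ => ENNReal.ofReal T.card) z)
        + ∫⁻ z in 𝒟, (cuspStrip Y).indicator (fun z => ENNReal.ofReal (averagedMass B z)) z := by
        have m1 : Measurable ((nearArc (5 * τ)).indicator fun _ => ENNReal.ofReal T.card) :=
          measurable_const.indicator (measurableSet_nearArc (5 * τ))
        rw [lintegral_add_left (by fun_prop), lintegral_add_left measurable_const,
          setLIntegral_const]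
    _ ≤ ENNReal.ofReal (48 / k) * volume 𝒟
        + ENNReal.ofReal T.card * volume (nearArc (5 * τ))
        + ∫⁻ z in cuspStrip Y, ENNReal.ofReal (averagedMass B z) := by
        refine add_le_add (add_le_add_right ?_ _) ?_
        · refine (setLIntegral_le_lintegral _ _).trans ?_
          rw [lintegral_indicator (measurableSet_nearArc _), setLIntegral_const]
        · refine (setLIntegral_le_lintegral _ _).trans ?_
          rw [lintegral_indicator (measurableSet_cuspStrip _)]
    _ ≤ ENNReal.ofReal (48 / k) * ENNReal.ofReal (Real.pi / 3)
        + ENNReal.ofReal T.card * ENNReal.ofReal (4 / 3 * (5 * τ))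
        + ENNReal.ofReal (B.card : ℝ)⁻¹ * ENNReal.ofReal (k / Y + 2) := by
        rw [volume_fd, setLIntegral_averagedMass]
        gcongr
        · exact volume_nearArc_le (by positivity)
        · exact sum_lintegral_cuspStrip_le hB (by omega) hY2
    _ ≤ _ := by
        have hYpos : 0 < Y := by linarith
        rw [← ENNReal.ofReal_mul (by positivity), ← ENNReal.ofReal_mul (by positivity),
          ← ENNReal.ofReal_mul (by positivity), ← ENNReal.ofReal_add (by positivity) (by positivity),
          ← ENNReal.ofReal_add (by positivity) (by positivity)]
        refine ENNReal.ofReal_le_ofReal ?_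
        have h1 : 48 / (k : ℝ) * (Real.pi / 3) ≤ 48 / k * (4 / 3) := by
          gcongr
          exact Real.pi_le_four
        have h2 : (B.card : ℝ)⁻¹ * (k / Y + 2) = k / B.card * (2 * τ + 2 / k) := by
          have : k / Y = k * (2 * τ) := by rw [hY]; field_simp
          rw [this]
          field_simp
        have h3 : (k : ℝ) / B.card * (2 * τ + 2 / k) ≤ 24 * (2 * τ + 2 / k) := by gcongr
        have h4 : (0 : ℝ) ≤ T.card * τ := by positivity
        rw [h2]
        have h5 : 48 / (k : ℝ) * (4 / 3) + 24 * (2 / k) ≤ 150 / k := by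
          have : 48 / (k : ℝ) * (4 / 3) + 24 * (2 / k) = 112 / k := by ring
          rw [this]
          gcongr
          norm_num
        linarith

/-- The function has integral `1 - 1 = 0`, and `|u| = 2u⁺ - u`; a one-sided bound therefore controls
the whole `L¹` norm. -/
lemma integral_abs_averagedMass_sub (hB : IsPeterssonOrthonormalBasis B) (h0 : 0 < B.card) {P : ℝ}
    (hP0 : 0 ≤ P)
    (hP : ∫⁻ z in 𝒟, ENNReal.ofReal (averagedMass B z - 3 / Real.pi) ≤ ENNReal.ofReal P) :
    IntegrableOn (fun z => averagedMass B z - 3 / Real.pi) 𝒟 ∧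
      ∫ z in 𝒟, |averagedMass B z - 3 / Real.pi| ≤ 2 * P := by
  have hlin := lintegral_averagedMass_fd hB h0
  have hmeas := (continuous_averagedMass B).measurable
  have hint : IntegrableOn (averagedMass B) 𝒟 := by
    refine ⟨hmeas.aestronglyMeasurable, ?_⟩
    rw [hasFiniteIntegral_iff_ofReal (Filter.Eventually.of_forall (averagedMass_nonneg B)), hlin]
    exact ENNReal.one_lt_top
  have hval : ∫ z in 𝒟, averagedMass B z = 1 := by
    rw [integral_eq_lintegral_of_nonneg_ae (Filter.Eventually.of_forall (averagedMass_nonneg B))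
      hmeas.aestronglyMeasurable, hlin, ENNReal.toReal_one]
  have hconst : IntegrableOn (fun _ : ℍ => 3 / Real.pi) 𝒟 :=
    integrableOn_const (by rw [volume_fd]; exact ENNReal.ofReal_ne_top)
  have hcval : ∫ _ in (𝒟 : Set ℍ), 3 / Real.pi = 1 := by
    rw [setIntegral_const, Measure.real, volume_fd,
      ENNReal.toReal_ofReal (by have := Real.pi_pos; positivity), smul_eq_mul]
    field_simp
  have hu : IntegrableOn (fun z => averagedMass B z - 3 / Real.pi) 𝒟 := hint.sub hconst
  refine ⟨hu, ?_⟩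
  have hu0 : ∫ z in 𝒟, (averagedMass B z - 3 / Real.pi) = 0 := by
    rw [integral_sub hint hconst, hval, hcval, sub_self]
  have hmax : ∫ z in 𝒟, max (averagedMass B z - 3 / Real.pi) 0 ≤ P := by
    have hnn : 0 ≤ᵐ[(volume : Measure ℍ).restrict 𝒟]
        fun z => max (averagedMass B z - 3 / Real.pi) 0 :=
      Filter.Eventually.of_forall fun z => le_max_right _ _
    rw [integral_eq_lintegral_of_nonneg_ae hnn hu.pos_part.aestronglyMeasurable]
    refine ENNReal.toReal_le_of_le_ofReal hP0 (le_trans (le_of_eq ?_) hP)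
    refine lintegral_congr fun z => ?_
    rw [ENNReal.ofReal_max, ENNReal.ofReal_zero, max_eq_left zero_le]
  have habs (z : ℍ) : |averagedMass B z - 3 / Real.pi|
      = 2 * max (averagedMass B z - 3 / Real.pi) 0 - (averagedMass B z - 3 / Real.pi) := by
    rcases le_total 0 (averagedMass B z - 3 / Real.pi) with h | h
    · rw [abs_of_nonneg h, max_eq_left h]; ring
    · rw [abs_of_nonpos h, max_eq_right h]; ring
  simp_rw [habs]
  rw [integral_sub (hu.pos_part.const_mul 2) hu, hu0, integral_const_mul]
  linarith

lemma measurable_proj : Measurable ModularSurface.proj := measurable_quotient_mk''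

lemma integral_averagedMassMeasure_sub {φ : ModularSurface → ℂ} (hφ : Measurable φ) {A : ℝ}
    (hA : ∀ p, ‖φ p‖ ≤ A) (hB : IsPeterssonOrthonormalBasis B) (h0 : 0 < B.card) {P : ℝ}
    (hP0 : 0 ≤ P)
    (hP : ∫⁻ z in 𝒟, ENNReal.ofReal (averagedMass B z - 3 / Real.pi) ≤ ENNReal.ofReal P) :
    ‖(∫ p, φ p ∂(averagedMassMeasure B))
        - ((3 / Real.pi : ℝ) : ℂ) * ∫ p, φ p ∂ModularSurface.hyperbolicMeasure‖ ≤ A * (2 * P) := by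
  obtain ⟨hu, habs⟩ := integral_abs_averagedMass_sub hB h0 hP0 hP
  have hmeas := (continuous_averagedMass B).measurable
  have hψ : Measurable fun z : ℍ => φ (ModularSurface.proj z) := hφ.comp measurable_proj
  have hconst : IntegrableOn (fun _ : ℍ => 3 / Real.pi) 𝒟 :=
    integrableOn_const (by rw [volume_fd]; exact ENNReal.ofReal_ne_top)
  have hb : IntegrableOn (averagedMass B) 𝒟 := by
    have := hu.add hconst
    simpa [Pi.add_def] using this
  have hA' : ∀ᵐ z ∂((volume : Measure ℍ).restrict 𝒟), ‖φ (ModularSurface.proj z)‖ ≤ A :=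
    Filter.Eventually.of_forall fun z => hA _
  have e1 : ∫ p, φ p ∂(averagedMassMeasure B)
      = ∫ z in 𝒟, (averagedMass B z : ℂ) * φ (ModularSurface.proj z) := by
    rw [averagedMassMeasure, integral_map measurable_proj.aemeasurable hφ.aestronglyMeasurable,
      integral_withDensity_eq_integral_toReal_smul hmeas.ennreal_ofReal
        (Filter.Eventually.of_forall fun z => ENNReal.ofReal_lt_top)]
    refine integral_congr_ae (Filter.Eventually.of_forall fun z => ?_)
    simp only [ENNReal.toReal_ofReal (averagedMass_nonneg B z), Complex.real_smul]
  have e2 : ∫ p, φ p ∂ModularSurface.hyperbolicMeasure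
      = ∫ z in 𝒟, φ (ModularSurface.proj z) := by
    rw [ModularSurface.hyperbolicMeasure,
      integral_map measurable_proj.aemeasurable hφ.aestronglyMeasurable]
  have i1 : Integrable (fun z => (averagedMass B z : ℂ) * φ (ModularSurface.proj z))
      ((volume : Measure ℍ).restrict 𝒟) :=
    hb.ofReal.mul_bdd hψ.aestronglyMeasurable hA'
  have i2 : Integrable (fun z => ((3 / Real.pi : ℝ) : ℂ) * φ (ModularSurface.proj z))
      ((volume : Measure ℍ).restrict 𝒟) :=
    hconst.ofReal.mul_bdd hψ.aestronglyMeasurable hA'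
  rw [e1, e2, ← integral_const_mul, ← integral_sub i1 i2]
  calc _ ≤ ∫ z in 𝒟, |averagedMass B z - 3 / Real.pi| * A := by
        refine norm_integral_le_of_norm_le (hu.abs.mul_const A) (Filter.Eventually.of_forall
          fun z => ?_)
        rw [← sub_mul, ← Complex.ofReal_sub, norm_mul, Complex.norm_real, Real.norm_eq_abs]
        gcongr
        exact hA _
    _ = A * ∫ z in 𝒟, |averagedMass B z - 3 / Real.pi| := by
        rw [integral_mul_const, mul_comm]
    _ ≤ A * (2 * P) := by
        have : 0 ≤ A := (norm_nonneg _).trans (hA (ModularSurface.proj UpperHalfPlane.I))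
        gcongr

lemma exists_radius {k : ℕ} (hk : 48 ≤ k)
    (h : √(Real.log k / k) ≤ 1 / 600) :
    ∃ s : ℝ, 0 < s ∧ k ≤ (1 + s ^ 2) ^ (k - 1) ∧
      2 * s * √(1 + s ^ 2) ≤ 6 * √(Real.log k / k) := by
  have hkR : (48 : ℝ) ≤ k := by exact_mod_cast hk
  have hlog : 0 < Real.log k := Real.log_pos (by linarith)
  set E := √(Real.log k / k) with hE
  have hE0 : 0 < E := Real.sqrt_pos.2 (by positivity)
  have hE2 : E ^ 2 = Real.log k / k := Real.sq_sqrt (by positivity)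
  -- The choice `s² = 4 log k / k` works because `log (1 + x) ≥ x / 2` on `[0, 1]` gives `(k - 1)
  -- log (1 + s²) ≥ 2 (k - 1) log k / k ≥ log k`.
  refine ⟨2 * E, by positivity, ?_, ?_⟩
  · have hs1 : (2 * E) ^ 2 ≤ 1 := by nlinarith
    have hlb : (2 * E) ^ 2 / 2 ≤ Real.log (1 + (2 * E) ^ 2) := by
      have h1 := Real.one_sub_inv_le_log_of_pos (show 0 < 1 + (2 * E) ^ 2 by positivity)
      refine le_trans ?_ h1
      have hx : 0 ≤ (2 * E) ^ 2 := by positivity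
      generalize (2 * E) ^ 2 = x at hs1 hx ⊢
      rw [← sub_nonneg]
      have : 1 - (1 + x)⁻¹ - x / 2 = x * (1 - x) / (2 * (1 + x)) := by
        field_simp
        ring
      rw [this]
      exact div_nonneg (mul_nonneg hx (by linarith)) (by positivity)
    have h2 : Real.log k ≤ ((k - 1 : ℕ) : ℝ) * Real.log (1 + (2 * E) ^ 2) := by
      have h3 : ((k - 1 : ℕ) : ℝ) = k - 1 := by
        rw [Nat.cast_sub (by omega), Nat.cast_one]
      calc Real.log k = k / 2 * (2 * E ^ 2) := by
            rw [hE2]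
            field_simp
        _ ≤ (k - 1) * (2 * E ^ 2) := by
            gcongr
            linarith
        _ = (k - 1) * ((2 * E) ^ 2 / 2) := by ring
        _ ≤ _ := by
            rw [h3]
            gcongr
            linarith
    rw [← Real.log_pow] at h2
    exact (Real.log_le_log_iff (by linarith) (by positivity)).1 h2
  · have h1 : √(1 + (2 * E) ^ 2) ≤ 3 / 2 := by
      rw [Real.sqrt_le_left (by norm_num)]
      nlinarith
    calc 2 * (2 * E) * √(1 + (2 * E) ^ 2) ≤ 2 * (2 * E) * (3 / 2) := by gcongr
      _ = _ := by ring

/-- Continuity descends through the quotient map; with compact support it gives the measurability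
and boundedness needed for the `L¹` estimate. -/
lemma continuous_of_isSmooth {φ : ModularSurface → ℂ} (h : ModularSurface.IsSmooth φ) :
    Continuous φ := by
  have hc : Continuous fun z : ℍ => φ (ModularSurface.proj z) := ContMDiff.continuous h
  exact isQuotientMap_quotient_mk'.continuous_iff.2 hc

end assembly

end

theorem mainTheorem3 :
    ∃ k₀ : ℕ, ∀ φ : ModularSurface → ℂ,
      ModularSurface.IsSmooth φ → HasCompactSupport φ →
      ∃ C : ℝ, ∀ k : ℕ, k₀ ≤ k → Even k →
        ∀ B : Finset (CuspForm 𝒮ℒ (k : ℤ)), IsPeterssonOrthonormalBasis B →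
          ‖(∫ p, φ p ∂(averagedMassMeasure B))
              - ((3 / Real.pi : ℝ) : ℂ) * ∫ p, φ p ∂ModularSurface.hyperbolicMeasure‖
            ≤ C * ((k : ℝ) ^ (-(1 / 2) : ℝ) * (Real.log (k : ℝ)) ^ (1 / 2 : ℝ)) := by
  have hlim : Filter.Tendsto (fun k : ℕ => √(Real.log k / k)) Filter.atTop (nhds 0) := by
    have h1 : Filter.Tendsto (fun k : ℕ => Real.log k / (k : ℝ)) Filter.atTop (nhds 0) :=
      Real.isLittleO_log_id_atTop.tendsto_div_nhds_zero.comp tendsto_natCast_atTop_atTop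
    simpa using h1.sqrt
  -- The threshold `1 / 600` ensures that `τ = 6 √(log k / k)` is at most `1 / 100`.
  obtain ⟨k₁, hk₁⟩ := Filter.eventually_atTop.1
    (hlim.eventually (ge_mem_nhds (show (0 : ℝ) < 1 / 600 by norm_num)))
  refine ⟨max 48 k₁, fun φ hφ hsupp => ?_⟩
  have hcont := continuous_of_isSmooth hφ
  have hmeasφ : Measurable φ := measurable_from_quotient.2
    (hcont.comp continuous_quotient_mk').measurable
  obtain ⟨A, hA⟩ := hcont.bounded_above_of_compact_support hsupp
  set T : Finset SL(2, ℤ) := finite_entries_le_one.toFinset with hT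
  refine ⟨A * (2 * (150 + (7 * T.card + 48) * 6)), fun k hk hk2 B hB => ?_⟩
  have hk48 : 48 ≤ k := (le_max_left _ _).trans hk
  have hkR : (48 : ℝ) ≤ k := by exact_mod_cast hk48
  have hE := hk₁ k ((le_max_right _ _).trans hk)
  have hlog : 1 ≤ Real.log k := by
    rw [Real.le_log_iff_exp_le (by linarith)]
    linarith [Real.exp_one_lt_d9]
  obtain ⟨s, hs, hsk, hsτ⟩ := exists_radius hk48 hE
  have hEeq : (k : ℝ) ^ (-(1 / 2) : ℝ) * (Real.log (k : ℝ)) ^ (1 / 2 : ℝ)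
      = √(Real.log k / k) := by
    rw [Real.sqrt_div' _ (by linarith), Real.rpow_neg (by linarith), ← Real.sqrt_eq_rpow,
      ← Real.sqrt_eq_rpow]
    ring
  rw [hEeq]
  set E := √(Real.log k / k) with hEdef
  have hE0 : 0 ≤ E := Real.sqrt_nonneg _
  -- The `O(1 / k)` errors are absorbed into the main rate.
  have hkE : 1 / (k : ℝ) ≤ E := by
    refine Real.le_sqrt_of_sq_le ?_
    rw [div_pow, one_pow, div_le_div_iff₀ (by positivity) (by positivity)]
    nlinarith
  have hP := lintegral_averagedMass_sub_le (T := T) (fun γ hγ => by simpa [hT] using hγ) hB hk48 hk2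
    hs hsk hsτ (by linarith)
  have hcard := card_ge hB (by omega) hk2
  have h0 : 0 < B.card := by
    have : (0 : ℝ) < B.card := by linarith
    exact_mod_cast this
  have hA0 : 0 ≤ A := (norm_nonneg _).trans (hA (ModularSurface.proj UpperHalfPlane.I))
  refine (integral_averagedMassMeasure_sub hmeasφ hA hB h0 (by positivity) hP).trans ?_
  have h150 : 150 / (k : ℝ) ≤ 150 * E := by
    calc 150 / (k : ℝ) = 150 * (1 / k) := by ring
      _ ≤ _ := by gcongr
  calc A * (2 * (150 / k + (7 * T.card + 48) * (6 * E)))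
      ≤ A * (2 * (150 * E + (7 * T.card + 48) * (6 * E))) := by gcongr
    _ = _ := by ring
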